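/- Let $M$ be a compact connected boundaryless smooth manifold of finite dimension, let $m$ be the volume of some Riemannian metric on $M$ normalized by $m(M)=1$, and let $d_M$ be the distance of some Riemannian metric on $M$, with open balls $B(x,\rho)$. Let $n\ge 1$, let $B^n$ be the open Euclidean unit ball of $\mathbb R^n$, and let $f:M\times B^n\to M$ be a $C^1$ map such that $f_t=f(\cdot,t)$ is a ($C^1$) diffeomorphism of $M$ for every $t\in B^n$. Let $a\in B^n$ and $\varepsilon>0$ be such that the closed Euclidean ball $T=\overline B^n(a,\varepsilon)$ is contained in $B^n$, and suppose that $f_a$ is a diffeomorphism of class $C^r$, $r\ge 1$. Let $\nu$ be the normalized Lebesgue measure on $T$, let $\Delta=T^{\mathbb N}$ with the product topology and the product measure $\nu^\infty$, and for $\underline t=(t_1,t_2,\dots)\in\Delta$ put $f^0(x,\underline t)=x$, $f^k(x,\underline t)=f_{t_k}\circ\dots\circ f_{t_1}(x)$. Let $f^k(x,\Delta)$ be the image of $\Delta$ and $f^k(x,\nu^\infty)$ the push-forward of $\nu^\infty$ under $f^k(x,\cdot)$, and let $S(x,\underline t)=(f_{t_1}(x),(t_2,t_3,\dots))$ on $M\times\Delta$.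 A Borel probability measure $\mu$ on $M$ is called stationary if $\mu\times\nu^\infty$ is $S$-invariant, stationary ergodic if moreover $\mu\times\nu^\infty$ is $S$-ergodic, and physical if it is stationary ergodic and $m(E(\mu))>0$, where $E(\mu)$ is the set of $x\in M$ such that for $\nu^\infty$-a.e. $\underline t$ one has $\lim_{N\to\infty}\frac1N\sum_{j=0}^{N-1}\varphi(f^j(x,\underline t))=\int\varphi\,d\mu$ for every $\varphi\in C(M,\mathbb R)$. Suppose there are $K\in\mathbb N$ and $\xi_0>0$ such that for all $k\ge K$ and all $x\in M$: (A) $f^k(x,\Delta)\supset B(f_a^k(x),\xi_0)$; (B) $f^k(x,\nu^\infty)\ll m$. Then there are finitely many probability measures $\mu_1,\dots,\mu_l$ on $M$ such that: 1. every $\mu_i$ is physical and absolutely continuous with respect to $m$; 2. $\operatorname{supp}\mu_i\cap\operatorname{supp}\mu_j=\emptyset$ for all $1\le i<j\le l$; 3. for every $x\in M$ there are open sets $V_1(x),\dots,V_l(x)\subset\Delta$ such that (a) $V_i(x)\cap V_j(x)=\emptyset$ for $1\le i<j\le l$; (b) $\nu^\infty\bigl(\Delta\setminus(V_1(x)\cup\dots\cup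 V_l(x))\bigr)=0$; (c) for every $1\le i\le l$ and $\nu^\infty$-a.e. $\underline t\in V_i(x)$, $\lim_{N\to\infty}\frac1N\sum_{j=0}^{N-1}\varphi(f^j(x,\underline t))=\int\varphi\,d\mu_i$ for every $\varphi\in C(M,\mathbb R)$. Moreover, each $V_i(x)$ depends continuously on $x\in M$ with respect to the distance $d_\nu(A,B)=\nu^\infty(A\,\triangle\,B)$ between $\nu^\infty$-mod $0$ subsets of $\Delta$. -/

import Mathlib

open MeasureTheory Metric Set Filter Topology
open scoped Bundle Manifold ContDiff ENNReal

noncomputable section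

/-! ### Riemannian volume -/

/-- Smooth Riemannian metrics on the smooth `d`-dimensional manifold `M`. -/
abbrev SmoothRiemannianMetric (d : ℕ) (M : Type*) [TopologicalSpace M]
    [ChartedSpace (EuclideanSpace ℝ (Fin d)) M] [IsManifold (𝓡 d) ∞ M] : Type _ :=
  Bundle.ContMDiffRiemannianMetric (𝓡 d) ∞ (EuclideanSpace ℝ (Fin d))
    (fun x : M => TangentSpace (𝓡 d) x)

section RiemannianVolume

variable {d : ℕ} {M : Type*} [TopologicalSpace M]
  [ChartedSpace (EuclideanSpace ℝ (Fin d)) M] [IsManifold (𝓡 d) ∞ M]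

/-- The `i`-th coordinate vector field `∂/∂y_i` of the chart `e`, at the point of `M` with
coordinates `y`. -/
def coordVector (e : OpenPartialHomeomorph M (EuclideanSpace ℝ (Fin d)))
    (y : EuclideanSpace ℝ (Fin d)) (i : Fin d) : TangentSpace (𝓡 d) (e.symm y) :=
  mfderiv (𝓡 d) (𝓡 d) e.symm y (EuclideanSpace.single i (1 : ℝ))

/-- The matrix `(g_{ij}(y))` of the metric `g` in the chart `e`. -/
def gramMatrix (g : SmoothRiemannianMetric d M)
    (e : OpenPartialHomeomorph M (EuclideanSpace ℝ (Fin d)))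
    (y : EuclideanSpace ℝ (Fin d)) : Matrix (Fin d) (Fin d) ℝ :=
  Matrix.of fun i j => g.inner (e.symm y) (coordVector e y i) (coordVector e y j)

/-- `vol` is the Riemannian volume measure of `g`: in every chart of the atlas it is
`√(det g_{ij}) dy`. -/
def IsRiemannianVolume [MeasurableSpace M] (g : SmoothRiemannianMetric d M)
    (vol : Measure M) : Prop :=
  ∀ e ∈ atlas (EuclideanSpace ℝ (Fin d)) M, ∀ s : Set M, MeasurableSet s → s ⊆ e.source →
    vol s = ∫⁻ y in e '' s, ENNReal.ofReal (Real.sqrt (gramMatrix g e y).det)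

/-- `m` is the Riemannian volume of `g` divided by the total volume, so that `m(M) = 1`. -/
def IsNormalizedRiemannianVolume [MeasurableSpace M] (g : SmoothRiemannianMetric d M)
    (m : Measure M) : Prop :=
  IsProbabilityMeasure m ∧
    ∃ vol : Measure M, IsRiemannianVolume g vol ∧ m = (vol univ)⁻¹ • vol

end RiemannianVolume

/-! ### Parametric noise -/

/-- A `C¹` family `f : M × Bⁿ → M` of diffeomorphisms of `M` parametrized by the open unit ball
of `ℝⁿ`, together with a parameter `a` and a noise level `ε > 0` such that the closed `ε`-ball
around `a` is contained in the open unit ball. The values of `f x t` for `t` outside the unit ball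
are irrelevant. -/
structure ParametricNoise (d n : ℕ) (M : Type*) [TopologicalSpace M]
    [ChartedSpace (EuclideanSpace ℝ (Fin d)) M] where
  /-- the family `f`, with `f_t = fun x => f x t` -/
  f : M → EuclideanSpace ℝ (Fin n) → M
  contMDiffOn : ContMDiffOn ((𝓡 d).prod (𝓡 n)) (𝓡 d) 1
    (fun p : M × EuclideanSpace ℝ (Fin n) => f p.1 p.2) (univ ×ˢ ball 0 1)
  diffeo : ∀ t ∈ ball (0 : EuclideanSpace ℝ (Fin n)) 1,
    ∃ φ : M ≃ₘ^1⟮𝓡 d, 𝓡 d⟯ M, ∀ x, φ x = f x t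
  /-- the centre of the noise -/
  a : EuclideanSpace ℝ (Fin n)
  /-- the noise level -/
  ε : ℝ
  ε_pos : 0 < ε
  closedBall_subset : closedBall a ε ⊆ ball 0 1

namespace ParametricNoise

variable {d n : ℕ} {M : Type*} [TopologicalSpace M]
  [ChartedSpace (EuclideanSpace ℝ (Fin d)) M]

/-- The one-step parameter space `T`, the closed `ε`-ball around `a`. -/
abbrev T (N : ParametricNoise d n M) : Type := closedBall N.a N.ε

/-- The perturbation space `Δ = T^ℕ`, with the product topology and σ-algebra. The entry of index
`j` of a sequence is the parameter used at step `j + 1`. -/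
abbrev Δ (N : ParametricNoise d n M) : Type := ℕ → N.T

/-- Normalized Lebesgue measure on `T`. -/
def ν (N : ParametricNoise d n M) : Measure N.T :=
  (volume (closedBall N.a N.ε))⁻¹ • Measure.comap Subtype.val volume

instance (N : ParametricNoise d n M) : IsProbabilityMeasure N.ν := by
  constructor
  have h : Measure.comap (Subtype.val : N.T → EuclideanSpace ℝ (Fin n)) volume univ
      = volume (closedBall N.a N.ε) := by
    rw [comap_subtype_coe_apply isClosed_closedBall.measurableSet, image_univ,
      Subtype.range_coe]
  rw [ν, Measure.smul_apply, h, smul_eq_mul]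
  exact ENNReal.inv_mul_cancel (measure_closedBall_pos _ _ N.ε_pos).ne'
    measure_closedBall_lt_top.ne

/-- The product measure `ν^∞` on `Δ`. -/
def νinf (N : ParametricNoise d n M) : Measure N.Δ := Measure.infinitePi fun _ : ℕ => N.ν

instance (N : ParametricNoise d n M) : IsProbabilityMeasure N.νinf := by
  unfold νinf; infer_instance

/-- Perturbed iterates `f^k(z, t) = f_{t_k} ∘ ⋯ ∘ f_{t_1} (z)`. -/
def iter (N : ParametricNoise d n M) : ℕ → M → N.Δ → M
  | 0, z, _ => z
  | k + 1, z, t => N.f (N.iter k z t) (t k)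

/-- The skew shift `S(z, t) = (f_{t_1}(z), σ t)` on `M × Δ`. -/
def shift (N : ParametricNoise d n M) (p : M × N.Δ) : M × N.Δ :=
  (N.f p.1 (p.2 0), fun j => p.2 (j + 1))

/-- The Birkhoff averages of every continuous function along the `t`-orbit of `x` converge to the
integral with respect to `μ`. -/
def AveragesTo [MeasurableSpace M] (N : ParametricNoise d n M) (μ : Measure M) (x : M)
    (t : N.Δ) : Prop :=
  ∀ φ : C(M, ℝ), Tendsto
    (fun k : ℕ => (k : ℝ)⁻¹ * ∑ j ∈ Finset.range k, φ (N.iter j x t)) atTop (𝓝 (∫ z, φ z ∂μ))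

/-- The set `E(μ)` of `μ`-generic points: the ergodic basin, when `μ` is stationary ergodic. -/
def basin [MeasurableSpace M] (N : ParametricNoise d n M) (μ : Measure M) : Set M :=
  {x | ∀ᵐ t ∂N.νinf, N.AveragesTo μ x t}

/-- `μ` is a stationary probability measure: `μ × ν^∞` is invariant under the skew shift. -/
def IsStationary [MeasurableSpace M] (N : ParametricNoise d n M) (μ : Measure M) : Prop :=
  IsProbabilityMeasure μ ∧ MeasurePreserving N.shift (μ.prod N.νinf) (μ.prod N.νinf)

/-- `μ` is a stationary ergodic probability measure: it is stationary and `μ × ν^∞` is ergodic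
for the skew shift. -/
def IsStationaryErgodic [MeasurableSpace M] (N : ParametricNoise d n M) (μ : Measure M) : Prop :=
  N.IsStationary μ ∧ Ergodic N.shift (μ.prod N.νinf)

/-- `μ` is a physical measure: a stationary ergodic probability measure whose ergodic basin has
positive volume. -/
def IsPhysical [MeasurableSpace M] (N : ParametricNoise d n M) (m μ : Measure M) : Prop :=
  N.IsStationaryErgodic μ ∧ 0 < m (N.basin μ)

end ParametricNoise

end

/-! The physical measures correspond to the minimal nonempty closed sets invariant under all maps
`f_s`, `s ∈ T`. By (A) such a set contains a ball of radius `ξ₀`, and distinct ones are disjoint, so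
compactness leaves finitely many (`finite_setOf_isMinimalInvariant`). The probability of ever
hitting an open set is lower semicontinuous in the initial point and harmonic off the open set, so a
minimum below one would be attained on a closed invariant set missing it. Hence almost every orbit
enters the interior of some minimal set (`IsForwardInvariant.ae_exists_iter_mem`). `V_i(x)` is the
open set of noises steering `x` into the interior of `C_i`. These sets partition `Δ` mod 0 and none
can lose much measure abruptly, so none can gain much either, which gives continuity.

On a minimal set `C`, Krylov–Bogoliubov yields a stationary `μ`, and (B) makes it absolutely
continuous. The key is `IsMinimalInvariant.forall_ae_mem`. For a shift-invariant `A`, let `E` be the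
set of `x ∈ C` with `(x, t) ∈ A` almost surely. If `m E > 0`, then `E` has a Lebesgue density point.
Density is transported along every noisy orbit, because the maps are local diffeomorphisms in charts
and almost every parameter keeps almost all of `E` in `E`. By (A), `E` then fills a ball up to a
null set. Almost every orbit from any point of `C` visits that ball after time `K` and, by (B),
avoids the null exception, so it visits `E`.

With a zero-one law for invariant sets this gives ergodicity. Applied to the set where Birkhoff
averages converge, it extends convergence from `μ`-almost every point to every point of `C`, hence
to almost every orbit that enters `C`. -/

open scoped NNReal

/-! ### Birkhoff's theorem for ergodic maps, through the maximal inequality. -/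

section Birkhoff

variable {Ω : Type*} {T : Ω → Ω} {g : Ω → ℝ}

/-- The maximum of the Birkhoff sums of `g` of length at most `n`. -/
def maxBirkhoffSum (T : Ω → Ω) (g : Ω → ℝ) : ℕ → Ω → ℝ
  | 0, _ => 0
  | n + 1, x => max 0 (g x + maxBirkhoffSum T g n (T x))

lemma maxBirkhoffSum_nonneg (n : ℕ) (x : Ω) : 0 ≤ maxBirkhoffSum T g n x := by
  cases n with
  | zero => exact le_rfl
  | succ n => exact le_max_left _ _

lemma maxBirkhoffSum_le_succ (n : ℕ) (x : Ω) :
    maxBirkhoffSum T g n x ≤ maxBirkhoffSum T g (n + 1) x := by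
  induction n generalizing x with
  | zero => exact maxBirkhoffSum_nonneg _ _
  | succ n ih => exact max_le_max le_rfl (add_le_add le_rfl (ih _))

lemma birkhoffSum_le_maxBirkhoffSum (n : ℕ) (x : Ω) :
    birkhoffSum T g n x ≤ maxBirkhoffSum T g n x := by
  induction n generalizing x with
  | zero => simp [maxBirkhoffSum]
  | succ n ih =>
    rw [birkhoffSum_succ']
    exact (add_le_add le_rfl (ih _)).trans (le_max_right _ _)

variable [MeasurableSpace Ω] {μ : Measure Ω}

lemma integrable_maxBirkhoffSum (hT : MeasurePreserving T μ μ) (hg : Integrable g μ) (n : ℕ) :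
    Integrable (maxBirkhoffSum T g n) μ := by
  induction n with
  | zero => exact integrable_zero _ _ _
  | succ n ih => exact (integrable_zero _ _ _).sup (hg.add (hT.integrable_comp_of_integrable ih))

/-- Garsia's argument: with `M_n` the maximal sum, `M_n - M_n ∘ T` is at most `g` where `M_n > 0`
and at most `0` elsewhere, while its integral vanishes by invariance. -/
lemma setIntegral_maxBirkhoffSum_pos_nonneg (hT : MeasurePreserving T μ μ) (hg : Integrable g μ)
    (n : ℕ) : 0 ≤ ∫ x in {x | 0 < maxBirkhoffSum T g n x}, g x ∂μ := by
  have hi := integrable_maxBirkhoffSum hT hg n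
  have hs : NullMeasurableSet {x | 0 < maxBirkhoffSum T g n x} μ :=
    nullMeasurableSet_lt aemeasurable_const hi.aemeasurable
  have hc : Integrable (fun x => maxBirkhoffSum T g n (T x)) μ :=
    hT.integrable_comp_of_integrable hi
  have h0 : ∫ x, (maxBirkhoffSum T g n x - maxBirkhoffSum T g n (T x)) ∂μ = 0 := by
    have : ∫ x, maxBirkhoffSum T g n (T x) ∂μ = ∫ x, maxBirkhoffSum T g n x ∂μ := by
      have h := integral_map (f := maxBirkhoffSum T g n) hT.measurable.aemeasurable
        (by rw [hT.map_eq]; exact hi.aestronglyMeasurable)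
      rw [hT.map_eq] at h
      exact h.symm
    rw [integral_sub hi hc, this, sub_self]
  rw [← integral_indicator₀ hs]
  refine h0.symm.le.trans ?_
  refine integral_mono (hi.sub hc) (hg.indicator₀ hs) fun x => ?_
  by_cases hx : 0 < maxBirkhoffSum T g n x
  · rw [indicator_of_mem (show x ∈ {x | 0 < maxBirkhoffSum T g n x} from hx)]
    cases n with
    | zero => exact absurd hx (lt_irrefl _)
    | succ n =>
      have h1 : maxBirkhoffSum T g (n + 1) x = g x + maxBirkhoffSum T g n (T x) := by
        refine max_eq_right (le_of_lt ?_)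
        by_contra h
        exact hx.ne' (max_eq_left (not_lt.1 h))
      have h2 := maxBirkhoffSum_le_succ (T := T) (g := g) n (T x)
      simp only
      linarith
  · rw [indicator_of_notMem (show x ∉ {x | 0 < maxBirkhoffSum T g n x} from hx)]
    have := maxBirkhoffSum_nonneg (T := T) (g := g) n (T x)
    simp only
    linarith

/-- A consequence of the maximal ergodic theorem. -/
lemma integral_nonneg_of_ae_exists_birkhoffSum_pos (hT : MeasurePreserving T μ μ)
    (hg : Integrable g μ) (h : ∀ᵐ x ∂μ, ∃ n, 0 < birkhoffSum T g n x) : 0 ≤ ∫ x, g x ∂μ := by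
  have hs : ∀ n, NullMeasurableSet {x | 0 < maxBirkhoffSum T g n x} μ := fun n =>
    nullMeasurableSet_lt aemeasurable_const (integrable_maxBirkhoffSum hT hg n).aemeasurable
  have ht : Tendsto (fun n => ∫ x, {x | 0 < maxBirkhoffSum T g n x}.indicator g x ∂μ) atTop
      (𝓝 (∫ x, g x ∂μ)) := by
    refine tendsto_integral_of_dominated_convergence (fun x => ‖g x‖)
      (fun n => (hg.indicator₀ (hs n)).aestronglyMeasurable) hg.norm
      (fun n => ae_of_all _ fun x => norm_indicator_le_norm_self _ _) ?_
    filter_upwards [h] with x ⟨n, hn⟩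
    refine tendsto_const_nhds.congr' ?_
    filter_upwards [eventually_ge_atTop n] with k hk
    rw [indicator_of_mem]
    exact hn.trans_le ((birkhoffSum_le_maxBirkhoffSum n x).trans
      (monotone_nat_of_le_succ (f := fun j => maxBirkhoffSum T g j x)
        (fun j => maxBirkhoffSum_le_succ j x) hk))
  refine ge_of_tendsto' ht fun n => ?_
  rw [integral_indicator₀ (hs n)]
  exact setIntegral_maxBirkhoffSum_pos_nonneg hT hg n

/-- Boundedness of the sums is a `T`-invariant condition, hence null or full. Were it null, almost
every point would have a positive sum, contradicting the maximal inequality. -/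
lemma Ergodic.ae_bddAbove_birkhoffSum (hT : Ergodic T μ) (hgm : Measurable g)
    (hg : Integrable g μ) (h : ∫ x, g x ∂μ < 0) :
    ∀ᵐ x ∂μ, ∃ C : ℕ, ∀ n, birkhoffSum T g n x ≤ C := by
  set B : Set Ω := {x | ∃ C : ℕ, ∀ n, birkhoffSum T g n x ≤ C}
  have hS : ∀ n, Measurable (birkhoffSum T g n) := fun n => by
    unfold birkhoffSum
    exact Finset.measurable_sum _ fun i _ => hgm.comp (hT.measurable.iterate i)
  have hB : MeasurableSet B := by
    simp only [B, ofPred_exists, ofPred_forall]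
    exact MeasurableSet.iUnion fun C => MeasurableSet.iInter fun n =>
      measurableSet_le (hS n) measurable_const
  have hinv : T ⁻¹' B = B := by
    ext x
    constructor
    · rintro ⟨C, hC⟩
      obtain ⟨D, hD⟩ := exists_nat_ge (|g x| + C)
      refine ⟨D, fun n => ?_⟩
      cases n with
      | zero => simp
      | succ n =>
        rw [birkhoffSum_succ']
        linarith [hC n, le_abs_self (g x)]
    · rintro ⟨C, hC⟩
      obtain ⟨D, hD⟩ := exists_nat_ge (|g x| + C)
      refine ⟨D, fun n => ?_⟩
      have := hC (n + 1)
      rw [birkhoffSum_succ'] at this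
      linarith [neg_abs_le (g x)]
  rcases hT.toPreErgodic.ae_empty_or_univ hB hinv with h0 | h0
  · refine absurd (integral_nonneg_of_ae_exists_birkhoffSum_pos hT.toMeasurePreserving hg ?_)
      (not_le.2 h)
    filter_upwards [h0] with x hx
    have hx' : x ∉ B := fun hxB => by
      have : (x ∈ B) = (x ∈ (∅ : Set Ω)) := hx
      rw [this] at hxB
      exact hxB
    by_contra! hcon
    exact hx' ⟨0, fun n => by simpa using hcon n⟩
  · filter_upwards [h0] with x hx
    exact (iff_of_eq hx).2 trivial

lemma Ergodic.ae_eventually_birkhoffAverage_le [IsProbabilityMeasure μ] (hT : Ergodic T μ)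
    (hgm : Measurable g) (hg : Integrable g μ) :
    ∀ᵐ x ∂μ, ∀ ε > 0, ∀ᶠ n : ℕ in atTop,
      (n : ℝ)⁻¹ * ∑ j ∈ Finset.range n, g (T^[j] x) ≤ ∫ x, g x ∂μ + ε := by
  have key : ∀ k : ℕ, ∀ᵐ x ∂μ, ∃ C : ℕ, ∀ n,
      birkhoffSum T (fun x => g x - (∫ x, g x ∂μ + 1 / (k + 1 : ℝ))) n x ≤ C := fun k => by
    refine hT.ae_bddAbove_birkhoffSum (hgm.sub_const _) (hg.sub (integrable_const _)) ?_
    rw [integral_sub hg (integrable_const _)]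
    simp only [integral_const, probReal_univ, smul_eq_mul, one_mul]
    have : (0 : ℝ) < 1 / (k + 1) := by positivity
    linarith
  filter_upwards [ae_all_iff.2 key] with x hx ε hε
  -- Half of `ε` pays for the shift `1 / (k + 1)` of the mean, the other half for `C / n`.
  obtain ⟨k, hk⟩ := exists_nat_one_div_lt (half_pos hε)
  obtain ⟨C, hC⟩ := hx k
  obtain ⟨n₀, hn₀⟩ := exists_nat_gt (C / (ε / 2))
  filter_upwards [eventually_ge_atTop n₀, eventually_gt_atTop 0] with n hn hn0
  have hn0' : (0 : ℝ) < n := by exact_mod_cast hn0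
  have h1 := hC n
  simp only [birkhoffSum, Finset.sum_sub_distrib, Finset.sum_const, Finset.card_range,
    nsmul_eq_mul] at h1
  have h2 : (C : ℝ) < n * (ε / 2) := by
    rw [div_lt_iff₀ (half_pos hε)] at hn₀
    refine hn₀.trans_le ?_
    gcongr
  rw [inv_mul_le_iff₀ hn0']
  nlinarith

/-- Birkhoff's pointwise ergodic theorem, for ergodic maps. -/
theorem Ergodic.ae_tendsto_birkhoffAverage [IsProbabilityMeasure μ] (hT : Ergodic T μ)
    (hgm : Measurable g) (hg : Integrable g μ) :
    ∀ᵐ x ∂μ, Tendsto (fun n : ℕ => (n : ℝ)⁻¹ * ∑ j ∈ Finset.range n, g (T^[j] x)) atTop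
      (𝓝 (∫ x, g x ∂μ)) := by
  filter_upwards [hT.ae_eventually_birkhoffAverage_le hgm hg,
    hT.ae_eventually_birkhoffAverage_le hgm.neg hg.neg] with x h1 h2
  refine Metric.tendsto_nhds.2 fun ε hε => ?_
  filter_upwards [h1 (ε / 2) (half_pos hε), h2 (ε / 2) (half_pos hε)] with n h3 h4
  simp only [Pi.neg_apply, Finset.sum_neg_distrib, mul_neg, integral_neg] at h4
  rw [Real.dist_eq, abs_lt]
  constructor <;> linarith

end Birkhoff

/-! ### Lebesgue density in Euclidean space and its transport. -/

section ZeroDensity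

variable {E : Type*} [NormedAddCommGroup E] [NormedSpace ℝ E] [FiniteDimensional ℝ E]
  [MeasurableSpace E] [BorelSpace E]

/-- The set `Z` has Lebesgue density zero at `x`. -/
def HasZeroDensityAt (μ : Measure E) (Z : Set E) (x : E) : Prop :=
  Tendsto (fun r => μ (Z ∩ closedBall x r) / μ (closedBall x r)) (𝓝[>] 0) (𝓝 0)

variable (μ : Measure E) [μ.IsAddHaarMeasure]

/-- Almost every point of `Z` is a point of density one, even for nonmeasurable `Z`. -/
lemma measure_eq_zero_of_hasZeroDensityAt {W Z : Set E} (hWZ : W ⊆ Z)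
    (h : ∀ x ∈ W, HasZeroDensityAt μ Z x) : μ W = 0 := by
  by_contra hW
  have hne : NeBot (ae (μ.restrict W)) := by
    rw [ae_neBot]
    exact fun h0 => hW (Measure.restrict_eq_zero.1 h0)
  have h1 : ∀ᵐ x ∂μ.restrict W,
      Tendsto (fun r => μ (Z ∩ closedBall x r) / μ (closedBall x r)) (𝓝[>] 0) (𝓝 1) :=
    ae_restrict_of_ae_restrict_of_subset hWZ (Besicovitch.ae_tendsto_measure_inter_div μ Z)
  have h2 : ∃ᶠ x in ae (μ.restrict W), x ∈ W := by
    intro hcon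
    have h0 : μ.restrict W W = 0 := by
      simpa using (measure_eq_zero_iff_ae_notMem).2 hcon
    exact hW (by rwa [Measure.restrict_apply_self] at h0)
  obtain ⟨x, hxW, hx⟩ := (h2.and_eventually h1).exists
  exact one_ne_zero (tendsto_nhds_unique hx (h x hxW))

lemma exists_hasZeroDensityAt {W Z : Set E} (hZ : MeasurableSet Z) (hWZ : Disjoint W Z)
    (hW : μ W ≠ 0) : ∃ x ∈ W, HasZeroDensityAt μ Z x := by
  by_contra! hcon
  refine hW (measure_mono_null (fun x hx => ?_)
    (Besicovitch.ae_tendsto_measure_inter_div_of_measurableSet μ hZ))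
  intro hx'
  have hx' : Tendsto (fun r => μ (Z ∩ closedBall x r) / μ (closedBall x r)) (𝓝[>] 0)
    (𝓝 (Z.indicator 1 x)) := hx'
  refine hcon x hx ?_
  rwa [indicator_of_notMem (disjoint_left.1 hWZ hx)] at hx'

/-- Zero density is transported by a family of local diffeomorphisms, almost all of which map the
complement of `Z` to the complement of `Z'`. -/
lemma HasZeroDensityAt.image {P : Type*} [NormedAddCommGroup P] [NormedSpace ℝ P]
    {F : E × P → E} {F' : E × P →L[ℝ] E} {x₀ : E} {t₀ : P} (hF : HasStrictFDerivAt F F' (x₀, t₀))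
    (R : E →L[ℝ] E) (hR : ∀ y, F' (R y, 0) = y) {Z Z' V : Set E} (hV : V ∈ 𝓝 x₀)
    (hnull : ∃ᶠ t in 𝓝 t₀, μ {x ∈ V | x ∉ Z ∧ F (x, t) ∈ Z'} = 0)
    (hZ : HasZeroDensityAt μ Z x₀) : HasZeroDensityAt μ Z' (F (x₀, t₀)) := by
  set L : E →L[ℝ] E := F'.comp (ContinuousLinearMap.inl ℝ E P) with hL
  let Ls : L.NonlinearRightInverse :=
    { toFun := R
      -- The added `1` keeps this constant positive even if `R = 0`, so that its inverse bounds `c`.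
      nnnorm := ‖R‖₊ + 1
      bound' := fun y => by
        refine (R.le_opNorm y).trans ?_
        push_cast
        gcongr
        simp
      right_inv' := fun y => by simpa [hL] using hR y }
  set m : ℝ≥0 := Real.toNNReal |L.det| + 1 with hm
  have hmL : ENNReal.ofReal |L.det| < m := by
    rw [ENNReal.ofReal, ENNReal.coe_lt_coe, hm]
    exact lt_add_of_pos_right _ one_pos
  have hLs : (0 : ℝ≥0) < (‖R‖₊ + 1)⁻¹ := by positivity
  obtain ⟨c, hc, hcpos, hcL⟩ := ((addHaar_image_le_mul_of_det_lt μ L hmL).and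
    (Filter.Eventually.and (p := fun c => c ∈ Ioi (0 : ℝ≥0)) self_mem_nhdsWithin
      (nhdsWithin_le_nhds (Iio_mem_nhds hLs)))).exists
  have hcpos : 0 < c := hcpos
  have hκ : (0 : ℝ) < ((Ls.nnnorm : ℝ)⁻¹ - c) := by
    have : (c : ℝ) < ((‖R‖₊ + 1 : ℝ≥0) : ℝ)⁻¹ := by exact_mod_cast hcL
    exact sub_pos.2 this
  set κ : ℝ := (Ls.nnnorm : ℝ)⁻¹ - c with hκdef
  -- uniform linear approximation
  obtain ⟨ρ, hρ, hρV, hρF⟩ : ∃ ρ > 0, closedBall x₀ ρ ⊆ V ∧ ∀ t ∈ ball t₀ ρ,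
      ApproximatesLinearOn (fun x => F (x, t)) L (closedBall x₀ ρ) c := by
    have h1 := (hF.isLittleO.def (c := (c : ℝ)) (by exact_mod_cast hcpos))
    rw [nhds_prod_eq, eventually_prod_iff] at h1
    obtain ⟨pa, ha, pb, hb, hab⟩ := h1
    obtain ⟨ρ1, hρ1, h1⟩ := Metric.mem_nhds_iff.1 (ha.and hb)
    obtain ⟨ρ2, hρ2, h2⟩ := Metric.mem_nhds_iff.1 hV
    refine ⟨min ρ1 ρ2 / 2, by positivity, ?_, ?_⟩
    · refine (closedBall_subset_ball ?_).trans h2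
      linarith [min_le_right ρ1 ρ2, lt_min hρ1 hρ2]
    · intro t ht x hx y hy
      have hlt : min ρ1 ρ2 / 2 < ρ1 := by linarith [min_le_left ρ1 ρ2, lt_min hρ1 hρ2]
      have hmem : ∀ z ∈ closedBall x₀ (min ρ1 ρ2 / 2), (z, t) ∈ ball (x₀, t₀) ρ1 := by
        intro z hz
        rw [← ball_prod_same]
        exact ⟨closedBall_subset_ball hlt hz, ball_subset_ball hlt.le ht⟩
      have := hab (h1 (hmem x hx)).1 (h1 (hmem y hy)).2
      have hs : ((x, t) - (y, t) : E × P) = (x - y, 0) := by simp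
      simp only [hs] at this
      simpa [hL, Prod.norm_def] using this
  -- comparison of measures of balls
  set q : ℝ := 2 / κ with hq
  have hqpos : 0 < q := by positivity
  have hkey : ∀ᶠ r in 𝓝[>] (0 : ℝ), μ (Z' ∩ closedBall (F (x₀, t₀)) r) /
      μ (closedBall (F (x₀, t₀)) r) ≤ (m * ENNReal.ofReal (q ^ Module.finrank ℝ E)) *
        (μ (Z ∩ closedBall x₀ (q * r)) / μ (closedBall x₀ (q * r))) := by
    have hsmall : ∀ᶠ r in 𝓝[>] (0 : ℝ), q * r < ρ := by
      refine nhdsWithin_le_nhds ?_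
      have : Tendsto (fun r : ℝ => q * r) (𝓝 0) (𝓝 (q * 0)) := tendsto_id.const_mul q
      rw [mul_zero] at this
      exact this.eventually (gt_mem_nhds hρ)
    filter_upwards [hsmall, self_mem_nhdsWithin] with r hr hr0
    have hr0 : 0 < r := hr0
    have hcont : ∀ᶠ t in 𝓝 t₀, dist (F (x₀, t₀)) (F (x₀, t)) < r := by
      have h1 : ContinuousAt (fun t => F (x₀, t)) t₀ :=
        ContinuousAt.comp (g := F) (f := fun t => (x₀, t)) hF.hasFDerivAt.continuousAt
          (by fun_prop)
      filter_upwards [h1.eventually (ball_mem_nhds _ hr0)] with t ht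
      rw [dist_comm]
      exact ht
    -- The good parameter `t` may depend on `r`, so having good parameters arbitrarily near `t₀`
    -- suffices; `t₀` itself need not be one.
    obtain ⟨t, ht0, htr, htρ⟩ :=
      (hnull.and_eventually (hcont.and (ball_mem_nhds t₀ hρ))).exists
    have hA := (hρF t htρ).mono_set (closedBall_subset_closedBall hr.le)
    have hsurj := hA.surjOn_closedBall_of_nonlinearRightInverse Ls (b := x₀) (ε := q * r)
      (by positivity) subset_rfl
    have hrad : ((Ls.nnnorm : ℝ)⁻¹ - c) * (q * r) = 2 * r := by
      rw [← hκdef, hq]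
      field_simp
    rw [hrad] at hsurj
    have hsub : Z' ∩ closedBall (F (x₀, t₀)) r ⊆
        (fun x => F (x, t)) '' (closedBall x₀ (q * r) ∩ {x | F (x, t) ∈ Z'}) := by
      rintro y ⟨hyZ, hyr⟩
      have : y ∈ closedBall (F (x₀, t)) (2 * r) := by
        rw [mem_closedBall] at hyr ⊢
        linarith [dist_triangle y (F (x₀, t₀)) (F (x₀, t))]
      obtain ⟨x, hx, hxy⟩ := hsurj this
      have hxy : F (x, t) = y := hxy
      exact ⟨x, ⟨hx, by rw [mem_ofPred_eq, hxy]; exact hyZ⟩, hxy⟩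
    have hle : μ (Z' ∩ closedBall (F (x₀, t₀)) r) ≤ m * μ (Z ∩ closedBall x₀ (q * r)) := by
      refine (measure_mono hsub).trans ((hc _ _ (hA.mono_set inter_subset_left)).trans ?_)
      refine mul_le_mul' le_rfl ?_
      refine (measure_mono (t := (Z ∩ closedBall x₀ (q * r)) ∪
        {x ∈ V | x ∉ Z ∧ F (x, t) ∈ Z'}) ?_).trans ((measure_union_le (μ := μ) _ _).trans ?_)
      · rintro x ⟨hx1, hx2⟩
        by_cases hxZ : x ∈ Z
        · exact Or.inl ⟨hxZ, hx1⟩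
        · exact Or.inr ⟨hρV (closedBall_subset_closedBall hr.le hx1), hxZ, hx2⟩
      · rw [ht0, add_zero]
    have hball : μ (closedBall x₀ (q * r)) = ENNReal.ofReal (q ^ Module.finrank ℝ E) *
        μ (closedBall (F (x₀, t₀)) r) := by
      rw [Measure.addHaar_closedBall_mul μ x₀ hqpos.le hr0.le,
        Measure.addHaar_closedBall_center μ (F (x₀, t₀))]
    have hb0 : μ (closedBall (F (x₀, t₀)) r) ≠ 0 := (measure_closedBall_pos μ _ hr0).ne'
    have hbt : μ (closedBall (F (x₀, t₀)) r) ≠ ⊤ := measure_closedBall_lt_top.ne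
    have hQ0 : ENNReal.ofReal (q ^ Module.finrank ℝ E) ≠ 0 := by
      rw [Ne, ENNReal.ofReal_eq_zero, not_le]
      positivity
    rw [hball, mul_assoc, ← mul_div_assoc, ENNReal.mul_div_mul_left _ _ hQ0 ENNReal.ofReal_ne_top,
      ← mul_div_assoc]
    gcongr
  have hlim : Tendsto (fun r : ℝ => (m * ENNReal.ofReal (q ^ Module.finrank ℝ E)) *
        (μ (Z ∩ closedBall x₀ (q * r)) / μ (closedBall x₀ (q * r)))) (𝓝[>] 0) (𝓝 0) := by
    have h1 : Tendsto (fun r : ℝ => q * r) (𝓝[>] 0) (𝓝[>] 0) := by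
      refine tendsto_nhdsWithin_iff.2 ⟨?_, ?_⟩
      · have : Tendsto (fun r : ℝ => q * r) (𝓝 0) (𝓝 (q * 0)) := tendsto_id.const_mul q
        rw [mul_zero] at this
        exact this.mono_left nhdsWithin_le_nhds
      · filter_upwards [self_mem_nhdsWithin] with r hr
        exact mul_pos hqpos hr
    have h2 := ENNReal.Tendsto.const_mul (a := m * ENNReal.ofReal (q ^ Module.finrank ℝ E))
      (hZ.comp h1) (Or.inr (ENNReal.mul_ne_top ENNReal.coe_ne_top ENNReal.ofReal_ne_top))
    simpa using h2
  exact tendsto_of_tendsto_of_tendsto_of_le_of_le' tendsto_const_nhds hlim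
    (Eventually.of_forall fun _ => bot_le) hkey

end ZeroDensity

namespace OpenPartialHomeomorph

variable {d : ℕ} {M : Type*} [TopologicalSpace M]

lemma measurableSet_target_inter_preimage_symm [MeasurableSpace M] [BorelSpace M]
    (e : OpenPartialHomeomorph M (EuclideanSpace ℝ (Fin d))) {A : Set M} (hA : MeasurableSet A) :
    MeasurableSet (e.target ∩ e.symm ⁻¹' A) := by
  have h := (e.continuousOn_symm.domRestrict).measurable hA
  have h2 := (MeasurableEmbedding.subtype_coe e.open_target.measurableSet).measurableSet_image.2 h
  convert h2 using 1
  ext y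
  simp [and_comm]

/-- In the chart `e`, the point `x` is a Lebesgue density point of `A`. -/
def IsDensityPoint
    (e : OpenPartialHomeomorph M (EuclideanSpace ℝ (Fin d))) (A : Set M) (x : M) : Prop :=
  HasZeroDensityAt volume (e.target ∩ e.symm ⁻¹' Aᶜ) (e x)

end OpenPartialHomeomorph

/-! ### Density points along noisy orbits. -/

namespace ParametricNoise

variable {d n : ℕ} {M : Type*} [TopologicalSpace M]
  [ChartedSpace (EuclideanSpace ℝ (Fin d)) M] (N : ParametricNoise d n M)

/-- The open ball is dense in the closed one. Full support turns properties of almost every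
parameter into properties of a dense set of parameters. -/
instance : N.ν.IsOpenPosMeasure := by
  constructor
  intro U hU hne h0
  obtain ⟨V, hV, rfl⟩ := isOpen_induced_iff.1 hU
  obtain ⟨⟨t, ht⟩, htV⟩ := hne
  have h1 : (V ∩ ball N.a N.ε).Nonempty := by
    have : t ∈ closure (ball N.a N.ε) := by
      rw [closure_ball _ N.ε_pos.ne']
      exact ht
    exact mem_closure_iff.1 this V hV htV
  have h2 := (hV.inter isOpen_ball).measure_pos volume h1
  rw [ν, Measure.smul_apply, smul_eq_mul, mul_eq_zero, ENNReal.inv_eq_zero,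
    comap_subtype_coe_apply isClosed_closedBall.measurableSet] at h0
  rcases h0 with h0 | h0
  · exact measure_closedBall_lt_top.ne h0
  · refine h2.ne' (measure_mono_null ?_ h0)
    rintro s ⟨hs1, hs2⟩
    exact ⟨⟨s, ball_subset_closedBall hs2⟩, hs1, rfl⟩

lemma continuous_step : Continuous fun p : M × N.T => N.f p.1 p.2 :=
  N.contMDiffOn.continuousOn.comp_continuous (f := fun p : M × N.T => (p.1, (p.2 : EuclideanSpace ℝ (Fin n))))
    (by fun_prop) fun p => ⟨trivial, N.closedBall_subset p.2.2⟩

section Charts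

variable [IsManifold (𝓡 d) ∞ M] {e e' : OpenPartialHomeomorph M (EuclideanSpace ℝ (Fin d))}
  {x : M}

lemma contDiffAt_coord (he : e ∈ atlas (EuclideanSpace ℝ (Fin d)) M)
    (he' : e' ∈ atlas (EuclideanSpace ℝ (Fin d)) M) (hx : x ∈ e.source) (t : N.T)
    (hx' : N.f x t ∈ e'.source) :
    ContDiffAt ℝ 1 (fun p : EuclideanSpace ℝ (Fin d) × EuclideanSpace ℝ (Fin n) =>
      e' (N.f (e.symm p.1) p.2)) (e x, (t : EuclideanSpace ℝ (Fin n))) := by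
  have hM : IsManifold (𝓡 d) 1 M := IsManifold.of_le (n := ∞) (by simp)
  have h1 : ContMDiffAt ((𝓡 d).prod (𝓡 n)) (𝓡 d) 1
      (fun p : M × EuclideanSpace ℝ (Fin n) => N.f p.1 p.2) (x, (t : EuclideanSpace ℝ (Fin n))) :=
    N.contMDiffOn.contMDiffAt
      ((isOpen_univ.prod isOpen_ball).mem_nhds ⟨trivial, N.closedBall_subset t.2⟩)
  have h2 : ContMDiffAt (𝓡 d) (𝓡 d) 1 e' (N.f x t) :=
    contMDiffAt_of_mem_maximalAtlas (IsManifold.subset_maximalAtlas he') hx'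
  have h3 : ContMDiffAt (𝓡 d) (𝓡 d) 1 e.symm (e x) :=
    contMDiffAt_symm_of_mem_maximalAtlas (IsManifold.subset_maximalAtlas he) (e.map_source hx)
  have h4 : ContMDiffAt ((𝓡 d).prod (𝓡 n)) ((𝓡 d).prod (𝓡 n)) 1
      (fun p : EuclideanSpace ℝ (Fin d) × EuclideanSpace ℝ (Fin n) => (e.symm p.1, p.2))
      (e x, (t : EuclideanSpace ℝ (Fin n))) :=
    (ContMDiffAt.comp (x := (e x, (t : EuclideanSpace ℝ (Fin n)))) h3 contMDiffAt_fst).prodMk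
      contMDiffAt_snd
  have h5 := ContMDiffAt.comp_of_eq (x := (e x, (t : EuclideanSpace ℝ (Fin n)))) h1 h4
    (by simp [e.left_inv hx])
  have h6 := ContMDiffAt.comp_of_eq (x := (e x, (t : EuclideanSpace ℝ (Fin n)))) h2 h5
    (by simp [e.left_inv hx])
  rw [← contMDiffAt_iff_contDiffAt]
  rw [← modelWithCornersSelf_prod, chartedSpaceSelf_prod] at h6
  exact h6

/-- `R` is the derivative of the coordinate expression of the inverse of `f_t`. -/
lemma exists_rightInverse_fderiv_coord (he : e ∈ atlas (EuclideanSpace ℝ (Fin d)) M)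
    (he' : e' ∈ atlas (EuclideanSpace ℝ (Fin d)) M) (hx : x ∈ e.source) (t : N.T)
    (hx' : N.f x t ∈ e'.source) :
    ∃ R : EuclideanSpace ℝ (Fin d) →L[ℝ] EuclideanSpace ℝ (Fin d), ∀ y,
      fderiv ℝ (fun p : EuclideanSpace ℝ (Fin d) × EuclideanSpace ℝ (Fin n) =>
        e' (N.f (e.symm p.1) p.2)) (e x, (t : EuclideanSpace ℝ (Fin n))) (R y, 0) = y := by
  have hM : IsManifold (𝓡 d) 1 M := IsManifold.of_le (n := ∞) (by simp)
  obtain ⟨φ, hφ⟩ := N.diffeo t (N.closedBall_subset t.2)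
  set G : EuclideanSpace ℝ (Fin d) → EuclideanSpace ℝ (Fin d) :=
    fun y => e (φ.symm (e'.symm y)) with hG
  have hφx : φ.symm (N.f x t) = x := by rw [← hφ]; simp
  have hGy : G (e' (N.f x t)) = e x := by
    simp only [hG, e'.left_inv hx', hφx]
  have hGd : DifferentiableAt ℝ G (e' (N.f x t)) := by
    have h2 : ContMDiffAt (𝓡 d) (𝓡 d) 1 e x :=
      contMDiffAt_of_mem_maximalAtlas (IsManifold.subset_maximalAtlas he) hx
    have h3 : ContMDiffAt (𝓡 d) (𝓡 d) 1 e'.symm (e' (N.f x t)) :=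
      contMDiffAt_symm_of_mem_maximalAtlas (IsManifold.subset_maximalAtlas he')
        (e'.map_source hx')
    have h4 : ContMDiffAt (𝓡 d) (𝓡 d) 1 φ.symm (N.f x t) := φ.symm.contMDiff.contMDiffAt
    have h5 := ContMDiffAt.comp_of_eq (x := e' (N.f x t)) h4 h3 (e'.left_inv hx')
    have h6 := ContMDiffAt.comp_of_eq (x := e' (N.f x t)) h2 h5
      (by simp [e'.left_inv hx', hφx])
    exact (contMDiffAt_iff_contDiffAt.1 h6).differentiableAt one_ne_zero
  have hF := (N.contDiffAt_coord he he' hx t hx').differentiableAt one_ne_zero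
  set F : EuclideanSpace ℝ (Fin d) × EuclideanSpace ℝ (Fin n) → EuclideanSpace ℝ (Fin d) :=
    fun p => e' (N.f (e.symm p.1) p.2) with hFdef
  have hid : (fun y => F (G y, (t : EuclideanSpace ℝ (Fin n)))) =ᶠ[𝓝 (e' (N.f x t))] id := by
    have hc : ContinuousAt (fun y => φ.symm (e'.symm y)) (e' (N.f x t)) :=
      φ.symm.continuous.continuousAt.comp (e'.continuousAt_symm (e'.map_source hx'))
    have h1 : ∀ᶠ y in 𝓝 (e' (N.f x t)), φ.symm (e'.symm y) ∈ e.source := by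
      refine hc.eventually (e.open_source.mem_nhds ?_)
      simpa only [e'.left_inv hx', hφx] using hx
    filter_upwards [h1, e'.open_target.mem_nhds (e'.map_source hx')] with y hy hy'
    simp only [hFdef, hG, e.left_inv hy, id]
    rw [← hφ]
    simp [e'.right_inv hy']
  refine ⟨fderiv ℝ G (e' (N.f x t)), fun y => ?_⟩
  have hpair : HasFDerivAt (fun y => (G y, (t : EuclideanSpace ℝ (Fin n))))
      ((fderiv ℝ G (e' (N.f x t))).prod 0) (e' (N.f x t)) :=
    hGd.hasFDerivAt.prodMk (hasFDerivAt_const _ _)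
  have hF' : HasFDerivAt F (fderiv ℝ F (e x, (t : EuclideanSpace ℝ (Fin n))))
      (G (e' (N.f x t)), (t : EuclideanSpace ℝ (Fin n))) := by
    rw [hGy]
    exact hF.hasFDerivAt
  have hcomp := (hF'.comp (e' (N.f x t)) hpair).congr_of_eventuallyEq hid.symm
  have := hcomp.unique (hasFDerivAt_id _)
  simpa using congrArg (fun A => A y) this

end Charts

section Density

variable [MeasurableSpace M] [BorelSpace M]

/-- Fubini exchanges "every point, almost every parameter" for "almost every parameter, almost every
point", the form needed to transport density. -/
lemma ae_ae_mem_of_ae_step_mem (e : OpenPartialHomeomorph M (EuclideanSpace ℝ (Fin d)))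
    {A : Set M} (hA : MeasurableSet A) (hstep : ∀ x ∈ A, ∀ᵐ s : N.T ∂N.ν, N.f x s ∈ A) :
    ∀ᵐ s : N.T ∂N.ν, volume {y ∈ e.target | y ∉ e.target ∩ e.symm ⁻¹' Aᶜ ∧
      N.f (e.symm y) s ∈ Aᶜ} = 0 := by
  have hmeas : MeasurableSet {p : EuclideanSpace ℝ (Fin d) × N.T |
      ¬ (p.1 ∈ e.target ∧ e.symm p.1 ∈ A ∧ N.f (e.symm p.1) p.2 ∉ A)} := by
    have hc : Continuous fun p : e.target × N.T => e.symm p.1 :=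
      (e.continuousOn_symm.domRestrict).comp continuous_fst
    have h1 := (hc.measurable hA).inter
      ((N.continuous_step.comp (hc.prodMk continuous_snd)).measurable hA).compl
    have h2 := (((MeasurableEmbedding.subtype_coe e.open_target.measurableSet).prodMap
      (MeasurableEmbedding.id (α := N.T))).measurableSet_image.2 h1).compl
    convert h2 using 1
    ext ⟨y, s⟩
    simp
    tauto
  have h := (Measure.ae_ae_comm (μ := (volume : Measure (EuclideanSpace ℝ (Fin d))))
    (ν := N.ν) (p := fun y s => ¬ (y ∈ e.target ∧ e.symm y ∈ A ∧ N.f (e.symm y) s ∉ A))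
    hmeas).1 (Eventually.of_forall fun y => by
      by_cases hy : e.symm y ∈ A
      · filter_upwards [hstep _ hy] with s hs hcon using hcon.2.2 hs
      · exact Eventually.of_forall fun s hs => hy hs.2.1)
  filter_upwards [h] with s hs
  rw [ae_iff] at hs
  refine measure_mono_null ?_ hs
  rintro y ⟨hy, hy1, hy2⟩
  have hyA : e.symm y ∈ A := by
    by_contra hcon
    exact hy1 ⟨hy, hcon⟩
  exact not_not.2 ⟨hy, hyA, hy2⟩

variable [IsManifold (𝓡 d) ∞ M]

/-- The conclusion covers every `t`, not just almost every one, because parameters satisfying the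
almost-everywhere condition accumulate at each `t`. -/
lemma isDensityPoint_step {e e' : OpenPartialHomeomorph M (EuclideanSpace ℝ (Fin d))}
    (he : e ∈ atlas (EuclideanSpace ℝ (Fin d)) M)
    (he' : e' ∈ atlas (EuclideanSpace ℝ (Fin d)) M)
    {A : Set M} (hA : MeasurableSet A) (hstep : ∀ x ∈ A, ∀ᵐ s : N.T ∂N.ν, N.f x s ∈ A)
    {x : M} (hx : x ∈ e.source) (h : e.IsDensityPoint A x) (t : N.T)
    (hx' : N.f x t ∈ e'.source) : e'.IsDensityPoint A (N.f x t) := by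
  obtain ⟨R, hR⟩ := N.exists_rightInverse_fderiv_coord he he' hx t hx'
  have hF := (N.contDiffAt_coord he he' hx t hx').hasStrictFDerivAt one_ne_zero
  have hae := N.ae_ae_mem_of_ae_step_mem e hA hstep
  have hsrc : ∀ᶠ p : EuclideanSpace ℝ (Fin d) × N.T in 𝓝 (e x, t),
      N.f (e.symm p.1) p.2 ∈ e'.source := by
    have h1 : ContinuousAt (fun p : EuclideanSpace ℝ (Fin d) × N.T => (e.symm p.1, p.2))
        (e x, t) :=
      ((e.continuousAt_symm (e.map_source hx)).comp (x := (e x, t)) continuousAt_fst).prodMk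
        continuousAt_snd
    have h2 := N.continuous_step.continuousAt.comp h1
    refine h2.eventually (e'.open_source.mem_nhds ?_)
    simpa [e.left_inv hx] using hx'
  rw [nhds_prod_eq, eventually_prod_iff] at hsrc
  obtain ⟨pa, ha, pb, hb, hab⟩ := hsrc
  have hfreq : ∃ᶠ s in 𝓝 (t : EuclideanSpace ℝ (Fin n)),
      volume {y ∈ e.target ∩ {y | pa y} | y ∉ e.target ∩ e.symm ⁻¹' Aᶜ ∧
        e' (N.f (e.symm y) s) ∈ e'.target ∩ e'.symm ⁻¹' Aᶜ} = 0 := by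
    intro hcon
    have hopen : ∀ᶠ s : N.T in 𝓝 t, ¬ volume {y ∈ e.target ∩ {y | pa y} |
        y ∉ e.target ∩ e.symm ⁻¹' Aᶜ ∧
        e' (N.f (e.symm y) s) ∈ e'.target ∩ e'.symm ⁻¹' Aᶜ} = 0 :=
      continuous_subtype_val.continuousAt.eventually hcon
    obtain ⟨U, hU, hUo, htU⟩ := _root_.mem_nhds_iff.1 (hopen.and hb)
    rw [ae_iff] at hae
    refine (hUo.measure_pos N.ν ⟨t, htU⟩).ne' (measure_mono_null (fun s hs => ?_) hae)
    refine fun hs0 => ?_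
    obtain ⟨hs1, hs2⟩ := hU hs
    refine hs1 (measure_mono_null ?_ hs0)
    rintro y ⟨⟨hy1, hy2⟩, hy3, -, hy4⟩
    refine ⟨hy1, hy3, ?_⟩
    rwa [mem_preimage, e'.left_inv (hab hy2 hs2)] at hy4
  have := HasZeroDensityAt.image volume hF R hR
    (inter_mem (e.open_target.mem_nhds (e.map_source hx)) ha) hfreq h
  simpa [e.left_inv hx, OpenPartialHomeomorph.IsDensityPoint] using this

/-- Only positive times occur: a step may change the chart, whereas at time zero the density would
have to be compared directly between two charts. -/
lemma isDensityPoint_iter {A : Set M} (hA : MeasurableSet A)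
    (hstep : ∀ x ∈ A, ∀ᵐ s : N.T ∂N.ν, N.f x s ∈ A) {x : M}
    {e : OpenPartialHomeomorph M (EuclideanSpace ℝ (Fin d))}
    (he : e ∈ atlas (EuclideanSpace ℝ (Fin d)) M) (hx : x ∈ e.source) (h : e.IsDensityPoint A x)
    (k : ℕ) (t : N.Δ) {e' : OpenPartialHomeomorph M (EuclideanSpace ℝ (Fin d))}
    (he' : e' ∈ atlas (EuclideanSpace ℝ (Fin d)) M) (hx' : N.iter (k + 1) x t ∈ e'.source) :
    e'.IsDensityPoint A (N.iter (k + 1) x t) := by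
  induction k generalizing e' with
  | zero => exact N.isDensityPoint_step he he' hA hstep hx h (t 0) hx'
  | succ k ih =>
    exact N.isDensityPoint_step (chart_mem_atlas _ _) he' hA hstep (mem_chart_source _ _)
      (ih (chart_mem_atlas _ _) (mem_chart_source _ _)) (t (k + 1)) hx'

/-- An almost surely forward invariant set of positive measure has full measure in every set
which is covered by the images of some point of it. -/
lemma exists_measure_range_iter_sdiff_eq_zero [CompactSpace M] {m : Measure M}
    (hm : ∀ e ∈ atlas (EuclideanSpace ℝ (Fin d)) M, ∀ s : Set M, MeasurableSet s → s ⊆ e.source →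
      volume (e.target ∩ e.symm ⁻¹' s) = 0 → m s = 0)
    {A : Set M} (hA : MeasurableSet A) (hstep : ∀ x ∈ A, ∀ᵐ s : N.T ∂N.ν, N.f x s ∈ A)
    (hmA : m A ≠ 0) :
    ∃ x ∈ A, ∀ k, ∀ U : Set M, IsOpen U → U ⊆ range (N.iter (k + 1) x) → m (U \ A) = 0 := by
  obtain ⟨c, hc⟩ : ∃ c : Finset M, (⋃ x ∈ c, (chartAt (EuclideanSpace ℝ (Fin d)) x).source) = univ :=
    isCompact_univ.elim_finite_subcover
      (fun x : M => (chartAt (EuclideanSpace ℝ (Fin d)) x).source)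
      (fun x => (chartAt _ x).open_source)
      (fun x _ => mem_iUnion.2 ⟨x, mem_chart_source _ x⟩) |>.imp fun c hc => univ_subset_iff.1 hc
  have hcover : ∀ s : Set M, MeasurableSet s →
      (∀ x : M, volume ((chartAt (EuclideanSpace ℝ (Fin d)) x).target ∩
        (chartAt (EuclideanSpace ℝ (Fin d)) x).symm ⁻¹' s) = 0) → m s = 0 := by
    intro s hs h
    have : s ⊆ ⋃ x ∈ c, s ∩ (chartAt (EuclideanSpace ℝ (Fin d)) x).source := by
      rw [← inter_iUnion₂, hc, inter_univ]
    refine measure_mono_null this ((measure_biUnion_null_iff c.countable_toSet).2 fun x _ => ?_)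
    refine hm _ (chart_mem_atlas _ x) _ (hs.inter (chartAt _ x).open_source.measurableSet)
      inter_subset_right (measure_mono_null ?_ (h x))
    exact fun y hy => ⟨hy.1, hy.2.1⟩
  obtain ⟨x₀, hx₀⟩ : ∃ x : M, volume ((chartAt (EuclideanSpace ℝ (Fin d)) x).target ∩
        (chartAt (EuclideanSpace ℝ (Fin d)) x).symm ⁻¹' A) ≠ 0 := by
    by_contra! hcon
    exact hmA (hcover A hA hcon)
  set e := chartAt (EuclideanSpace ℝ (Fin d)) x₀
  have hdisj : Disjoint (e.target ∩ e.symm ⁻¹' A) (e.target ∩ e.symm ⁻¹' Aᶜ) :=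
    disjoint_left.2 fun y hy hy' => hy'.2 hy.2
  obtain ⟨y, ⟨hy, hyA⟩, hyd⟩ := exists_hasZeroDensityAt volume
    (e.measurableSet_target_inter_preimage_symm hA.compl) hdisj hx₀
  have hdens : e.IsDensityPoint A (e.symm y) := by
    rwa [OpenPartialHomeomorph.IsDensityPoint, e.right_inv hy]
  refine ⟨e.symm y, hyA, fun k U hU hUk => hcover _ (hU.measurableSet.diff hA) fun x => ?_⟩
  -- Every point of `U` is reached from the density point, so `Aᶜ` has density zero at each point of
  -- `U \ A`.
  refine measure_eq_zero_of_hasZeroDensityAt volume (Z := (chartAt _ x).target ∩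
    (chartAt (EuclideanSpace ℝ (Fin d)) x).symm ⁻¹' Aᶜ) (fun z hz => ⟨hz.1, hz.2.2⟩) ?_
  rintro z ⟨hz, hzU, -⟩
  obtain ⟨t, ht⟩ := hUk hzU
  have := N.isDensityPoint_iter hA hstep (chart_mem_atlas _ x₀) (e.map_target hy) hdens k t
    (chart_mem_atlas (EuclideanSpace ℝ (Fin d)) x) (by rw [ht]; exact (chartAt _ x).map_target hz)
  rw [ht] at this
  rwa [OpenPartialHomeomorph.IsDensityPoint, (chartAt _ x).right_inv hz] at this

end Density

end ParametricNoise

/-! ### Iterates, the skew shift and the Markov property. -/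

namespace ParametricNoise

section Continuity

variable {d n : ℕ} {M : Type*} [TopologicalSpace M]
  [ChartedSpace (EuclideanSpace ℝ (Fin d)) M] (N : ParametricNoise d n M)

lemma continuous_iter (k : ℕ) : Continuous fun p : M × N.Δ => N.iter k p.1 p.2 := by
  induction k with
  | zero => exact continuous_fst
  | succ k ih =>
    exact N.continuous_step.comp (ih.prodMk ((continuous_apply k).comp continuous_snd))

lemma continuous_shift : Continuous N.shift :=
  (N.continuous_step.comp
    (continuous_fst.prodMk ((continuous_apply 0).comp continuous_snd))).prodMk
    (continuous_pi fun j => (continuous_apply (j + 1)).comp continuous_snd)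

/-- `iter` peels off the last parameter; the skew shift needs the first. -/
lemma iter_succ' (k : ℕ) (x : M) (t : N.Δ) :
    N.iter (k + 1) x t = N.iter k (N.f x (t 0)) (fun j => t (j + 1)) := by
  induction k with
  | zero => rfl
  | succ k ih =>
    rw [iter, ih]
    rfl

lemma iterate_shift (k : ℕ) (p : M × N.Δ) :
    N.shift^[k] p = (N.iter k p.1 p.2, fun j => p.2 (j + k)) := by
  induction k generalizing p with
  | zero => rfl
  | succ k ih =>
    rw [Function.iterate_succ_apply, ih, iter_succ']
    simp only [shift, Prod.mk.injEq, true_and]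
    funext j
    congr 1

lemma iter_add (j k : ℕ) (x : M) (t : N.Δ) :
    N.iter (j + k) x t = N.iter j (N.iter k x t) (fun i => t (i + k)) := by
  have := congrArg Prod.fst (Function.iterate_add_apply N.shift j k (x, t))
  simpa only [iterate_shift] using this

lemma iterate_shift_mem_iff {A : Set (M × N.Δ)} (hinv : N.shift ⁻¹' A = A) (k : ℕ) (p : M × N.Δ) :
    N.shift^[k] p ∈ A ↔ p ∈ A := by
  have h : N.shift^[k] ⁻¹' A = A := by
    rw [preimage_iterate_eq, Function.iterate_fixed hinv]
  rw [← mem_preimage, h]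

/-- The sequence whose first `k` terms are those of `p.1`, followed by the sequence `p.2`. -/
def concat {α : Type*} (k : ℕ) (p : (ℕ → α) × (ℕ → α)) (j : ℕ) : α :=
  if j < k then p.1 j else p.2 (j - k)

lemma concat_apply_of_lt {α : Type*} {k : ℕ} (p : (ℕ → α) × (ℕ → α)) {j : ℕ} (h : j < k) :
    concat k p j = p.1 j := if_pos h

lemma concat_add {α : Type*} {k : ℕ} (p : (ℕ → α) × (ℕ → α)) (j : ℕ) :
    concat k p (j + k) = p.2 j := by
  simp [concat]

lemma measurable_concat {α : Type*} [MeasurableSpace α] (k : ℕ) :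
    Measurable (concat k : (ℕ → α) × (ℕ → α) → ℕ → α) := by
  refine measurable_pi_lambda _ fun j => ?_
  unfold concat
  split_ifs
  · exact (measurable_pi_apply j).comp measurable_fst
  · exact (measurable_pi_apply (j - k)).comp measurable_snd

lemma iter_concat (k : ℕ) (x : M) (p : N.Δ × N.Δ) : N.iter k x (concat k p) = N.iter k x p.1 := by
  suffices h : ∀ i ≤ k, N.iter i x (concat k p) = N.iter i x p.1 from h k le_rfl
  intro i hi
  induction i with
  | zero => rfl
  | succ i ih => rw [iter, iter, ih (by omega), concat_apply_of_lt p (by omega)]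

/-- The first `k` parameters are independent of the tail; this is the source of the Markov property.
It is checked on cylinders. -/
lemma measurePreserving_concat (k : ℕ) :
    MeasurePreserving (concat k) (N.νinf.prod N.νinf) N.νinf := by
  refine ⟨measurable_concat k, Measure.eq_infinitePi _ fun s A hA => ?_⟩
  set s' : Finset ℕ := s.preimage (· + k) (add_left_injective k).injOn
  have hpre : concat k ⁻¹' (Set.pi s A) =
      Set.pi (s.filter (· < k) : Finset ℕ) A ×ˢ Set.pi (s' : Set ℕ) (fun j => A (j + k)) := by
    ext p
    simp only [mem_preimage, Set.mem_pi, mem_prod, Finset.mem_coe, s', Finset.mem_preimage,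
      Finset.mem_filter]
    constructor
    · refine fun h => ⟨fun j hj => ?_, fun j hj => ?_⟩
      · simpa only [concat_apply_of_lt p hj.2] using h j hj.1
      · simpa only [concat_add] using h _ hj
    · rintro ⟨h1, h2⟩ j hj
      rcases lt_or_ge j k with hjk | hjk
      · rw [concat_apply_of_lt p hjk]
        exact h1 j ⟨hj, hjk⟩
      · obtain ⟨i, rfl⟩ := Nat.exists_eq_add_of_le' hjk
        rw [concat_add]
        exact h2 i hj
  have hs : s.filter (¬ · < k) = s'.map (addRightEmbedding k) := by
    ext j
    simp only [Finset.mem_filter, Finset.mem_map, s', Finset.mem_preimage, addRightEmbedding_apply]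
    constructor
    · rintro ⟨hj, hjk⟩
      obtain ⟨i, rfl⟩ := Nat.exists_eq_add_of_le' (not_lt.1 hjk)
      exact ⟨i, hj, rfl⟩
    · rintro ⟨i, hi, rfl⟩
      exact ⟨hi, by omega⟩
  rw [Measure.map_apply (measurable_concat k)
      (MeasurableSet.pi s.countable_toSet fun j _ => hA j), hpre,
    Measure.prod_prod, νinf, Measure.infinitePi_pi _ fun j _ => hA j,
    Measure.infinitePi_pi _ fun j _ => hA (j + k),
    ← Finset.prod_filter_mul_prod_filter_not s (· < k), hs, Finset.prod_map]
  rfl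

/-- The Feller property: the transition operator sends continuous test functions to continuous ones,
so it passes through weak limits. -/
lemma continuous_integral_step [FirstCountableTopology M] [CompactSpace M] (φ : C(M, ℝ)) :
    Continuous fun y => ∫ s : N.T, φ (N.f y s) ∂N.ν := by
  refine continuous_of_dominated (bound := fun _ => ‖φ‖) (fun y => ?_)
    (fun y => Eventually.of_forall fun s => φ.norm_coe_le_norm _) (integrable_const _)
    (Eventually.of_forall fun s => ?_)
  · exact (φ.continuous.comp
      (N.continuous_step.comp (Continuous.prodMk_right y))).aestronglyMeasurable
  · exact φ.continuous.comp (N.continuous_step.comp (Continuous.prodMk_left s))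

end Continuity

variable {d n : ℕ} {M : Type*} [MetricSpace M]
    [MeasurableSpace M] [BorelSpace M]
    [ChartedSpace (EuclideanSpace ℝ (Fin d)) M] (N : ParametricNoise d n M)

section Markov

lemma measurable_iter (k : ℕ) (x : M) : Measurable (N.iter k x) :=
  ((N.continuous_iter k).comp (Continuous.prodMk_right x)).measurable

/-- The Markov property. -/
lemma lintegral_iterate_shift (k : ℕ) {h : M × N.Δ → ℝ≥0∞} (hh : Measurable h) (x : M) :
    ∫⁻ t, h (N.iter k x t, fun j => t (j + k)) ∂N.νinf =
      ∫⁻ t, ∫⁻ t', h (N.iter k x t, t') ∂N.νinf ∂N.νinf := by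
  have hm : Measurable fun t : N.Δ => h (N.iter k x t, fun j => t (j + k)) :=
    hh.comp ((N.measurable_iter k x).prodMk
      (measurable_pi_lambda _ fun j => measurable_pi_apply (j + k)))
  rw [← (N.measurePreserving_concat k).lintegral_comp hm]
  simp only [iter_concat, concat_add]
  exact lintegral_prod (fun p : N.Δ × N.Δ => h (N.iter k x p.1, p.2))
    (hh.comp (((N.measurable_iter k x).comp measurable_fst).prodMk
      measurable_snd)).aemeasurable

lemma lintegral_shift {h : M × N.Δ → ℝ≥0∞} (hh : Measurable h) (x : M) :
    ∫⁻ t, h (N.shift (x, t)) ∂N.νinf = ∫⁻ s : N.T, ∫⁻ t, h (N.f x s, t) ∂N.νinf ∂N.ν := by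
  have h1 : Measurable fun s : N.T => N.f x s :=
    (N.continuous_step.comp (Continuous.prodMk_right x)).measurable
  refine (N.lintegral_iterate_shift 1 hh x).trans ?_
  exact (measurePreserving_eval_infinitePi (fun _ : ℕ => N.ν) 0).lintegral_comp
    ((hh.lintegral_prod_right' (ν := N.νinf)).comp h1)

lemma ae_iterate_shift_iff (k : ℕ) {A : Set (M × N.Δ)} (hA : MeasurableSet A) (x : M) :
    (∀ᵐ t ∂N.νinf, (N.iter k x t, fun j => t (j + k)) ∈ A) ↔
      ∀ᵐ t ∂N.νinf, ∀ᵐ t' ∂N.νinf, (N.iter k x t, t') ∈ A := by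
  have h := N.lintegral_iterate_shift k (measurable_one.indicator hA.compl) x
  have hm1 : Measurable fun t : N.Δ => (N.iter k x t, fun j => t (j + k)) :=
    (N.measurable_iter k x).prodMk (measurable_pi_lambda _ fun j => measurable_pi_apply (j + k))
  have hind : Measurable (Aᶜ.indicator (1 : M × N.Δ → ℝ≥0∞)) := measurable_one.indicator hA.compl
  have hm2 : Measurable fun t : N.Δ =>
      ∫⁻ t', Aᶜ.indicator (1 : M × N.Δ → ℝ≥0∞) (N.iter k x t, t') ∂N.νinf :=
    (hind.lintegral_prod_right' (ν := N.νinf)).comp (N.measurable_iter k x)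
  have aux : ∀ g : N.Δ → M × N.Δ, Measurable g → ((∀ᵐ t ∂N.νinf, g t ∈ A) ↔
      ∫⁻ t, Aᶜ.indicator (1 : M × N.Δ → ℝ≥0∞) (g t) ∂N.νinf = 0) := fun g hg => by
    rw [lintegral_eq_zero_iff (f := fun t => Aᶜ.indicator (1 : M × N.Δ → ℝ≥0∞) (g t))
      (hind.comp hg)]
    refine eventually_congr (Eventually.of_forall fun t => ?_)
    simp
  rw [aux _ hm1, h, lintegral_eq_zero_iff hm2]
  exact eventually_congr (Eventually.of_forall fun t => (aux _ measurable_prodMk_left).symm)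

/-- If a shift-invariant property holds almost surely for the initial points in `E`, then it holds
for almost every orbit that visits `E`. -/
lemma ae_forall_iter_mem_imp {A : Set (M × N.Δ)} (hA : MeasurableSet A) (hinv : N.shift ⁻¹' A = A)
    {E : Set M} (hE : MeasurableSet E) (h : ∀ x ∈ E, ∀ᵐ t ∂N.νinf, (x, t) ∈ A) (x : M) :
    ∀ᵐ t ∂N.νinf, ∀ k, N.iter k x t ∈ E → (x, t) ∈ A := by
  refine ae_all_iff.2 fun k => ?_
  have hm : MeasurableSet {p : M × N.Δ | p.1 ∈ E → p ∈ A} := by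
    have : {p : M × N.Δ | p.1 ∈ E → p ∈ A} = (Prod.fst ⁻¹' E)ᶜ ∪ A := by
      ext p
      simp [imp_iff_not_or]
    rw [this]
    exact (measurable_fst hE).compl.union hA
  have hae := (N.ae_iterate_shift_iff k hm x).2 (Eventually.of_forall fun t => by
    by_cases ht : N.iter k x t ∈ E
    · filter_upwards [h _ ht] with t' ht' _ using ht'
    · exact Eventually.of_forall fun t' h' => absurd h' ht)
  filter_upwards [hae] with t ht htE
  refine (N.iterate_shift_mem_iff hinv k (x, t)).1 ?_
  rw [iterate_shift]
  exact ht htE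

end Markov

/-! ### A one-step criterion for stationarity. -/

section Stationary

lemma measurePreserving_shift {μ : Measure M} [IsProbabilityMeasure μ]
    (h : (μ.prod N.ν).map (fun p => N.f p.1 p.2) = μ) :
    MeasurePreserving N.shift (μ.prod N.νinf) (μ.prod N.νinf) := by
  refine ⟨N.continuous_shift.measurable, Measure.ext_of_lintegral _ fun g hg => ?_⟩
  have hG : Measurable fun y => ∫⁻ t, g (y, t) ∂N.νinf := hg.lintegral_prod_right'
  rw [lintegral_map hg N.continuous_shift.measurable,
    lintegral_prod (fun p => g (N.shift p))
      (hg.comp N.continuous_shift.measurable).aemeasurable,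
    lintegral_prod _ hg.aemeasurable]
  simp only [N.lintegral_shift hg]
  conv_rhs => rw [← h]
  rw [lintegral_map hG N.continuous_step.measurable,
    lintegral_prod (fun p : M × N.T => ∫⁻ t, g (N.f p.1 p.2, t) ∂N.νinf)
      (hG.comp N.continuous_step.measurable).aemeasurable]

lemma integrable_of_continuous {X : Type*} [TopologicalSpace X] [CompactSpace X]
    [MeasurableSpace X] [OpensMeasurableSpace X] {μ : Measure X} [IsFiniteMeasure μ] {φ : X → ℝ}
    (h : Continuous φ) : Integrable φ μ :=
  h.integrable_of_hasCompactSupport (HasCompactSupport.of_compactSpace _)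

variable [CompactSpace M]

/-- The parameter `t k` is independent of the first `k` ones, so the pair it forms with the `k`-th
iterate has a product law. -/
lemma integral_step_iter (φ : C(M, ℝ)) (k : ℕ) (x : M) :
    ∫ t, ∫ s : N.T, φ (N.f (N.iter k x t) s) ∂N.ν ∂N.νinf = ∫ t, φ (N.iter (k + 1) x t) ∂N.νinf := by
  have hmap : N.νinf.map (fun t => (N.iter k x t, t k)) =
      (N.νinf.map (N.iter k x)).prod N.ν := by
    have hm1 : Measurable fun t : N.Δ => (N.iter k x t, t k) :=
      (N.measurable_iter k x).prodMk (measurable_pi_apply k)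
    refine Measure.ext_of_lintegral _ fun g hg => ?_
    have h1 := N.lintegral_iterate_shift k (h := fun p => g (p.1, p.2 0))
      (hg.comp (measurable_fst.prodMk ((measurable_pi_apply 0).comp measurable_snd))) x
    rw [lintegral_map hg hm1, lintegral_prod _ hg.aemeasurable,
      lintegral_map hg.lintegral_prod_right' (N.measurable_iter k x)]
    simp only [zero_add] at h1
    rw [h1]
    refine lintegral_congr fun t => ?_
    exact (measurePreserving_eval_infinitePi (fun _ : ℕ => N.ν) 0).lintegral_comp
      (hg.comp measurable_prodMk_left)
  have hφm : Continuous fun p : M × N.T => φ (N.f p.1 p.2) := φ.continuous.comp N.continuous_step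
  have h2 : Integrable (fun p : M × N.T => φ (N.f p.1 p.2)) ((N.νinf.map (N.iter k x)).prod N.ν) := by
    have := Measure.isProbabilityMeasure_map (μ := N.νinf) (N.measurable_iter k x).aemeasurable
    exact integrable_of_continuous hφm
  have h3 := integral_prod _ h2
  rw [← hmap, integral_map ((N.measurable_iter k x).prodMk (measurable_pi_apply k)).aemeasurable
    hφm.aestronglyMeasurable] at h3
  rw [integral_map (N.measurable_iter k x).aemeasurable
    (N.continuous_integral_step φ).aestronglyMeasurable] at h3
  exact h3.symm

end Stationary

end ParametricNoise

/-! ### Fibres of open sets in a product. -/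

section Fibers

variable {X Y : Type*} [TopologicalSpace X] [TopologicalSpace Y] [CompactSpace Y]
  [MeasurableSpace Y] [OpensMeasurableSpace Y] (ν : Measure Y) [IsFiniteMeasure ν]
  [ν.WeaklyRegular] {G : Set (X × Y)}

/-- A compact set filling most of the fibre over `x` stays inside the fibres over nearby points, by
the tube lemma. -/
lemma tendsto_measure_fiber_sdiff (hG : IsOpen G) (x : X) :
    Tendsto (fun y => ν (Prod.mk x ⁻¹' G \ Prod.mk y ⁻¹' G)) (𝓝 x) (𝓝 0) := by
  rw [ENNReal.tendsto_nhds_zero]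
  intro ε hε
  have hGx : IsOpen (Prod.mk x ⁻¹' G) := hG.preimage (Continuous.prodMk_right x)
  obtain ⟨Q, hQ, hQc, hQε⟩ := hGx.measurableSet.exists_isClosed_sdiff_lt (μ := ν)
    (measure_ne_top _ _) hε.ne'
  filter_upwards [hQc.isCompact.eventually_forall_of_forall_eventually (x₀ := x)
    (P := fun y t => (y, t) ∈ G) fun t ht => hG.mem_nhds (hQ ht)] with y hy
  refine (measure_mono ?_).trans hQε.le
  exact fun t ht => ⟨ht.1, fun htQ => ht.2 (hy t htQ)⟩

lemma lowerSemicontinuous_measure_fiber (hG : IsOpen G) :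
    LowerSemicontinuous fun x => ν (Prod.mk x ⁻¹' G) := by
  intro x c hc
  have h := tendsto_measure_fiber_sdiff ν hG x
  have hpos : 0 < ν (Prod.mk x ⁻¹' G) - c := tsub_pos_of_lt hc
  filter_upwards [h.eventually (gt_mem_nhds hpos)] with y hy
  by_contra! hcon
  refine absurd hy (not_lt.2 ?_)
  rw [tsub_le_iff_right]
  calc ν (Prod.mk x ⁻¹' G)
      ≤ ν (Prod.mk x ⁻¹' G \ Prod.mk y ⁻¹' G ∪ Prod.mk y ⁻¹' G) :=
        measure_mono (by rw [sdiff_union_self]; exact subset_union_left)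
    _ ≤ ν (Prod.mk x ⁻¹' G \ Prod.mk y ⁻¹' G) + ν (Prod.mk y ⁻¹' G) := measure_union_le _ _
    _ ≤ _ := by gcongr

/-- The members of a partition mod `0` of `Y` into open sets varying lower semicontinuously vary
continuously in measure. -/
lemma tendsto_measure_symmDiff_fiber {ι : Type*} [Fintype ι] {G : ι → Set (X × Y)}
    (hG : ∀ i, IsOpen (G i))
    (hdisj : ∀ x i j, i ≠ j → ∀ t ∈ Prod.mk x ⁻¹' G i, t ∉ Prod.mk x ⁻¹' G j)
    (hfull : ∀ x, ν (⋃ i, Prod.mk x ⁻¹' G i)ᶜ = 0) (i : ι) (x : X) :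
    Tendsto (fun y => ν (symmDiff (Prod.mk y ⁻¹' G i) (Prod.mk x ⁻¹' G i))) (𝓝 x) (𝓝 0) := by
  have hlim : Tendsto (fun y => ∑ j, ν (Prod.mk x ⁻¹' G j \ Prod.mk y ⁻¹' G j)) (𝓝 x) (𝓝 0) := by
    rw [show (0 : ℝ≥0∞) = ∑ j : ι, 0 by simp]
    exact tendsto_finsetSum _ fun j _ => tendsto_measure_fiber_sdiff ν (hG j) x
  refine tendsto_of_tendsto_of_tendsto_of_le_of_le tendsto_const_nhds hlim
    (fun _ => bot_le) fun y => ?_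
  -- What fibre `i` gains in passing from `x` to `y` is, up to a null set, lost by some other fibre.
  have hsub : symmDiff (Prod.mk y ⁻¹' G i) (Prod.mk x ⁻¹' G i) ⊆
      (⋃ j, Prod.mk x ⁻¹' G j)ᶜ ∪ ⋃ j, (Prod.mk x ⁻¹' G j \ Prod.mk y ⁻¹' G j) := by
    rintro t (⟨hty, htx⟩ | ⟨htx, hty⟩)
    · by_cases h : ∃ j, t ∈ Prod.mk x ⁻¹' G j
      · obtain ⟨j, hj⟩ := h
        have hij : i ≠ j := fun hij => htx (hij ▸ hj)
        exact Or.inr (mem_iUnion.2 ⟨j, hj, hdisj y i j hij t hty⟩)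
      · exact Or.inl fun h' => h (mem_iUnion.1 h')
    · exact Or.inr (mem_iUnion.2 ⟨i, htx, hty⟩)
  refine (measure_mono hsub).trans ((measure_union_le _ _).trans ?_)
  rw [hfull x, zero_add]
  exact measure_iUnion_fintype_le _ _

end Fibers

/-! ### Forward invariant sets: hitting probabilities and stationary measures. -/

namespace ParametricNoise

/-- The set `C` is mapped to itself by all the maps of the family. -/
def IsForwardInvariant {d n : ℕ} {M : Type*} [TopologicalSpace M]
    [ChartedSpace (EuclideanSpace ℝ (Fin d)) M] (N : ParametricNoise d n M) (C : Set M) : Prop :=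
  ∀ x ∈ C, ∀ s : N.T, N.f x s ∈ C

variable {d n : ℕ} {M : Type*} [MetricSpace M]
    [ChartedSpace (EuclideanSpace ℝ (Fin d)) M] {N : ParametricNoise d n M} {C : Set M}

lemma IsForwardInvariant.iter_mem (hC : N.IsForwardInvariant C) (k : ℕ) {x : M} (hx : x ∈ C)
    (t : N.Δ) : N.iter k x t ∈ C := by
  induction k with
  | zero => exact hx
  | succ k ih => exact hC _ ih _

lemma isOpen_setOf_exists_iter_mem {O : Set M} (hO : IsOpen O) :
    IsOpen {p : M × N.Δ | ∃ k, N.iter k p.1 p.2 ∈ O} := by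
  have : {p : M × N.Δ | ∃ k, N.iter k p.1 p.2 ∈ O} =
      ⋃ k, (fun p : M × N.Δ => N.iter k p.1 p.2) ⁻¹' O := by
    ext p
    simp
  rw [this]
  exact isOpen_iUnion fun k => hO.preimage (N.continuous_iter k)

variable [CompactSpace M] [MeasurableSpace M] [BorelSpace M]

/-- Almost every orbit in a closed forward invariant set `F` enters an open set that meets all
closed forward invariant subsets of `F`. -/
lemma IsForwardInvariant.ae_exists_iter_mem {F O : Set M} (hF : N.IsForwardInvariant F)
    (hFc : IsClosed F) (hO : IsOpen O)
    (h : ∀ C ⊆ F, IsClosed C → C.Nonempty → N.IsForwardInvariant C → (C ∩ O).Nonempty)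
    {x : M} (hx : x ∈ F) : ∀ᵐ t ∂N.νinf, ∃ k, N.iter k x t ∈ O := by
  set G : Set (M × N.Δ) := {p | ∃ k, N.iter k p.1 p.2 ∈ O} with hG
  have hGo : IsOpen G := isOpen_setOf_exists_iter_mem hO
  set g : M → ℝ≥0∞ := fun x => N.νinf (Prod.mk x ⁻¹' G) with hg
  have hlsc : LowerSemicontinuous g := lowerSemicontinuous_measure_fiber N.νinf hGo
  obtain ⟨x₀, hx₀, hmin⟩ := (hlsc.lowerSemicontinuousOn F).exists_isMinOn ⟨x, hx⟩ hFc.isCompact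
  have hmin : ∀ y ∈ F, g x₀ ≤ g y := fun y hy => hmin hy
  suffices h1 : 1 ≤ g x₀ by
    have h2 : N.νinf (Prod.mk x ⁻¹' G) = 1 := le_antisymm prob_le_one (h1.trans (hmin x hx))
    have h3 : MeasurableSet (Prod.mk x ⁻¹' G) :=
      (hGo.preimage (Continuous.prodMk_right x)).measurableSet
    exact (prob_compl_eq_zero_iff h3).2 h2
  by_contra! hlt
  have hgO : ∀ y ∈ O, g y = 1 := fun y hy => by
    have : Prod.mk y ⁻¹' G = univ := eq_univ_of_forall fun t => ⟨0, hy⟩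
    simp only [hg, this, measure_univ]
  have hclosed : IsClosed (g ⁻¹' Iic (g x₀)) := lowerSemicontinuous_iff_isClosed_preimage.1 hlsc _
  -- If the minimum of `g` is below `1`, the minimizers avoid `O`, where `g = 1`. Off `O`, `g` is
  -- the mean of its values after one step, so the minimizers form a closed invariant set, which
  -- should meet `O`.
  obtain ⟨y, ⟨-, hy⟩, hyO⟩ := h (F ∩ g ⁻¹' Iic (g x₀)) inter_subset_left (hFc.inter hclosed)
    ⟨x₀, hx₀, le_refl (g x₀)⟩ (by
      rintro y ⟨hyF, hy⟩ s
      have hyO : y ∉ O := fun hyO => absurd (hgO y hyO ▸ hy : (1 : ℝ≥0∞) ≤ g x₀) (not_le.2 hlt)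
      refine ⟨hF y hyF s, ?_⟩
      have hshift : ∀ t, (y, t) ∈ G ↔ N.shift (y, t) ∈ G := by
        intro t
        constructor
        · rintro ⟨k, hk⟩
          cases k with
          | zero => exact absurd hk hyO
          | succ k => exact ⟨k, by rwa [iter_succ'] at hk⟩
        · rintro ⟨k, hk⟩
          exact ⟨k + 1, by rwa [iter_succ']⟩
      have hgm : Measurable g := hlsc.measurable
      have hsm : Measurable fun s : N.T => g (N.f y s) :=
        hgm.comp (N.continuous_step.comp (Continuous.prodMk_right y)).measurable
      have hint : ∫⁻ s : N.T, g (N.f y s) ∂N.ν = g y := by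
        have h1 := N.lintegral_shift (measurable_one.indicator hGo.measurableSet) y
        have h2 : ∀ z, ∫⁻ t, G.indicator 1 (z, t) ∂N.νinf = g z := fun z => by
          have h3 : MeasurableSet (Prod.mk z ⁻¹' G) :=
            (hGo.preimage (Continuous.prodMk_right z)).measurableSet
          change _ = N.νinf (Prod.mk z ⁻¹' G)
          rw [← lintegral_indicator_one h3]
          rfl
        simp only [h2] at h1
        rw [← h1, ← h2]
        refine lintegral_congr fun t => ?_
        by_cases ht : (y, t) ∈ G
        · rw [indicator_of_mem ht, indicator_of_mem ((hshift t).1 ht)]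
          rfl
        · rw [indicator_of_notMem ht, indicator_of_notMem (mt (hshift t).2 ht)]
      have hae : ∀ᵐ s : N.T ∂N.ν, g x₀ = g (N.f y s) := by
        refine ae_eq_of_ae_le_of_lintegral_le
          (Eventually.of_forall fun s => hmin _ (hF y hyF s)) ?_ hsm.aemeasurable ?_
        · simp only [lintegral_const, measure_univ, mul_one]
          exact (hlt.trans_le le_top).ne
        · rw [hint]
          simpa using hy
      -- Almost every `s` leads to a minimizer; closedness and the full support of `ν` extend this
      -- to all `s`.
      by_contra hcon
      have hopen : IsOpen {s : N.T | N.f y s ∈ (g ⁻¹' Iic (g x₀))ᶜ} :=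
        hclosed.isOpen_compl.preimage (N.continuous_step.comp (Continuous.prodMk_right y))
      refine (hopen.measure_pos N.ν ⟨s, hcon⟩).ne' (measure_mono_null ?_ hae)
      exact fun s' hs' heq => hs' (le_of_eq (Eq.symm heq)))
  exact absurd ((hgO y hyO).symm.le.trans hy) (not_le.2 hlt)

/-- Krylov–Bogoliubov: a weak limit, along an ultrafilter, of Cesàro averages of the laws of the
iterates of one point of `C`. -/
lemma exists_isStationary (hC : N.IsForwardInvariant C) (hCc : IsClosed C) (hne : C.Nonempty) :
    ∃ μ : Measure M, N.IsStationary μ ∧ μ Cᶜ = 0 := by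
  obtain ⟨x, hx⟩ := hne
  have hlaw : ∀ k, IsProbabilityMeasure (N.νinf.map (N.iter k x)) := fun k =>
    Measure.isProbabilityMeasure_map (N.measurable_iter k x).aemeasurable
  let c : ℕ → Measure M := fun j =>
    ((j + 1 : ℕ) : ℝ≥0∞)⁻¹ • ∑ k ∈ Finset.range (j + 1), N.νinf.map (N.iter k x)
  have hc : ∀ j, IsProbabilityMeasure (c j) := fun j => by
    constructor
    simp only [c, Measure.smul_apply, Measure.finsetSum_apply, measure_univ, Finset.sum_const,
      Finset.card_range, nsmul_eq_mul, mul_one, smul_eq_mul]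
    exact ENNReal.inv_mul_cancel (by simp) (ENNReal.natCast_ne_top _)
  let p : ℕ → ProbabilityMeasure M := fun j => ⟨c j, hc j⟩
  set U := (hyperfilter ℕ).map p
  obtain ⟨μ, hμ⟩ : ∃ μ : ProbabilityMeasure M, Tendsto p (hyperfilter ℕ) (𝓝 μ) :=
    ⟨_, U.le_nhds_lim⟩
  have hint : ∀ (φ : C(M, ℝ)) j, ∫ y, φ y ∂(c j) =
      ((j + 1 : ℕ) : ℝ)⁻¹ * ∑ k ∈ Finset.range (j + 1), ∫ t, φ (N.iter k x t) ∂N.νinf := by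
    intro φ j
    simp only [c]
    rw [integral_smul_measure, integral_finsetSum_measure fun k _ =>
      integrable_of_continuous φ.continuous]
    simp only [ENNReal.toReal_inv, ENNReal.toReal_natCast, smul_eq_mul]
    congr 1
    exact Finset.sum_congr rfl fun k _ => integral_map (N.measurable_iter k x).aemeasurable
      φ.continuous.aestronglyMeasurable
  have hlim : ∀ φ : C(M, ℝ), Tendsto (fun j => ∫ y, φ y ∂(c j)) (hyperfilter ℕ)
      (𝓝 (∫ y, φ y ∂(μ : Measure M))) := fun φ =>
    ProbabilityMeasure.tendsto_iff_forall_integral_tendsto.1 hμ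
      (BoundedContinuousFunction.mkOfCompact φ)
  have hinv : ∀ φ : C(M, ℝ), ∫ y, ∫ s : N.T, φ (N.f y s) ∂N.ν ∂(μ : Measure M) =
      ∫ y, φ y ∂(μ : Measure M) := by
    intro φ
    set ψ : C(M, ℝ) := ⟨fun y => ∫ s : N.T, φ (N.f y s) ∂N.ν, N.continuous_integral_step φ⟩
    refine sub_eq_zero.1 (tendsto_nhds_unique ((hlim ψ).sub (hlim φ)) ?_)
    -- The Cesàro sums telescope, leaving two boundary terms divided by `j + 1`.
    have hsum : ∀ j, ∫ y, ψ y ∂(c j) - ∫ y, φ y ∂(c j) =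
        ((j + 1 : ℕ) : ℝ)⁻¹ * (∫ t, φ (N.iter (j + 1) x t) ∂N.νinf - φ x) := by
      intro j
      rw [hint, hint, ← mul_sub, ← Finset.sum_sub_distrib]
      congr 1
      have h1 : ∀ k, ∫ t, ψ (N.iter k x t) ∂N.νinf = ∫ t, φ (N.iter (k + 1) x t) ∂N.νinf :=
        fun k => N.integral_step_iter φ k x
      simp only [h1]
      rw [Finset.sum_range_sub (fun k => ∫ t, φ (N.iter k x t) ∂N.νinf)]
      simp [iter]
    have hz : Tendsto (fun j : ℕ => ((j + 1 : ℕ) : ℝ)⁻¹ *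
        (∫ t, φ (N.iter (j + 1) x t) ∂N.νinf - φ x)) atTop (𝓝 0) := by
      have h1 : Tendsto (fun j : ℕ => ((j + 1 : ℕ) : ℝ)⁻¹ * (2 * ‖φ‖)) atTop (𝓝 0) := by
        have := (tendsto_inv_atTop_nhds_zero_nat (𝕜 := ℝ)).comp (tendsto_add_atTop_nat 1)
        simpa using this.mul_const (2 * ‖φ‖)
      refine squeeze_zero_norm (fun j => ?_) h1
      rw [norm_mul, norm_inv, Real.norm_natCast]
      gcongr
      refine (norm_sub_le _ _).trans ?_
      have h2 : ‖∫ t, φ (N.iter (j + 1) x t) ∂N.νinf‖ ≤ ‖φ‖ := by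
        have := norm_integral_le_of_norm_le_const (μ := N.νinf)
          (f := fun t => φ (N.iter (j + 1) x t)) (C := ‖φ‖)
          (Eventually.of_forall fun t => φ.norm_coe_le_norm _)
        simpa using this
      linarith [φ.norm_coe_le_norm x]
    simp only [hsum]
    exact hz.mono_left Nat.hyperfilter_le_atTop
  refine ⟨μ, ⟨inferInstance, N.measurePreserving_shift ?_⟩, ?_⟩
  · have := Measure.isProbabilityMeasure_map (μ := (μ : Measure M).prod N.ν)
      N.continuous_step.measurable.aemeasurable
    refine ext_of_forall_integral_eq_of_IsFiniteMeasure fun φ => ?_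
    have hφm : Continuous fun p : M × N.T => φ (N.f p.1 p.2) := φ.continuous.comp N.continuous_step
    rw [integral_map N.continuous_step.measurable.aemeasurable
      φ.continuous.aestronglyMeasurable, integral_prod _ (integrable_of_continuous hφm)]
    exact hinv φ.toContinuousMap
  · have h1 := ProbabilityMeasure.le_liminf_measure_open_of_tendsto hμ hCc.isOpen_compl
    have h2 : ∀ j, (p j : Measure M) Cᶜ = 0 := fun j => by
      change c j Cᶜ = 0
      simp only [c, Measure.smul_apply, Measure.finsetSum_apply, smul_eq_mul]
      rw [Finset.sum_eq_zero, mul_zero]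
      intro k _
      rw [Measure.map_apply (N.measurable_iter k x) hCc.isOpen_compl.measurableSet]
      have : N.iter k x ⁻¹' Cᶜ = ∅ :=
        eq_empty_of_forall_notMem fun t ht => ht (hC.iter_mem k hx t)
      rw [this, measure_empty]
    simp only [h2] at h1
    simpa using h1

end ParametricNoise

namespace ParametricNoise

variable {d n : ℕ} {M : Type*} [MetricSpace M]
    [ChartedSpace (EuclideanSpace ℝ (Fin d)) M] {N : ParametricNoise d n M}

/-! ### A zero-one law for the skew shift. -/

section ZeroOne

variable [MeasurableSpace M]

lemma tendsto_concat {α : Type*} [TopologicalSpace α] (p : (ℕ → α) × (ℕ → α)) :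
    Tendsto (fun k => concat k p) atTop (𝓝 p.1) := by
  refine tendsto_pi_nhds.2 fun j => tendsto_const_nhds.congr' ?_
  filter_upwards [eventually_gt_atTop j] with k hk using (concat_apply_of_lt p hk).symm

lemma measurePreserving_prodMk_concat (N : ParametricNoise d n M) (μ : Measure M) [SFinite μ]
    (k : ℕ) :
    MeasurePreserving (fun p : (M × N.Δ) × N.Δ => (p.1.1, concat k (p.1.2, p.2)))
      ((μ.prod N.νinf).prod N.νinf) (μ.prod N.νinf) :=
  ((MeasurePreserving.id μ).prod (N.measurePreserving_concat k)).comp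
    (measurePreserving_prodAssoc μ N.νinf N.νinf)

variable [CompactSpace M] [BorelSpace M]

/-- Replacing the tail of the noise by an independent copy has little effect in `L¹`. -/
lemma tendsto_lintegral_enorm_concat_sub (μ : Measure M) [IsProbabilityMeasure μ]
    {u : M × N.Δ → ℝ} (hum : Measurable u) (hu : Integrable u (μ.prod N.νinf)) :
    Tendsto (fun k => ∫⁻ p, ‖u (p.1.1, concat k (p.1.2, p.2)) - u p.1‖ₑ
      ∂((μ.prod N.νinf).prod N.νinf)) atTop (𝓝 0) := by
  rw [ENNReal.tendsto_nhds_zero]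
  intro ε hε
  have hε3 : ε / 3 ≠ 0 := (ENNReal.div_pos hε.ne' (by norm_num)).ne'
  obtain ⟨φ, hφ, -⟩ := hu.exists_boundedContinuous_lintegral_sub_le hε3
  have hc := fun k => N.measurePreserving_prodMk_concat μ k
  have hfst : MeasurePreserving Prod.fst ((μ.prod N.νinf).prod N.νinf) (μ.prod N.νinf) :=
    measurePreserving_fst
  have hφm : Measurable φ := φ.continuous.measurable
  have hmid : Tendsto (fun k => ∫⁻ p, ‖φ (p.1.1, concat k (p.1.2, p.2)) - φ p.1‖ₑ
      ∂((μ.prod N.νinf).prod N.νinf)) atTop (𝓝 0) := by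
    have h := tendsto_lintegral_of_dominated_convergence
      (μ := (μ.prod N.νinf).prod N.νinf)
      (F := fun k p => ‖φ (p.1.1, concat k (p.1.2, p.2)) - φ p.1‖ₑ) (f := fun _ => 0)
      (fun _ => ‖φ‖ₑ + ‖φ‖ₑ)
      (fun k => ((hφm.comp (hc k).measurable).sub (hφm.comp measurable_fst)).enorm)
      (fun k => Eventually.of_forall fun p => (enorm_sub_le).trans
        (add_le_add (enorm_le_iff_norm_le.2 (φ.norm_coe_le_norm _))
          (enorm_le_iff_norm_le.2 (φ.norm_coe_le_norm _))))
      (by simp) (Eventually.of_forall fun p => ?_)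
    · simpa using h
    · have h1 : Tendsto (fun k => φ (p.1.1, concat k (p.1.2, p.2)) - φ p.1) atTop
          (𝓝 (φ p.1 - φ p.1)) :=
        ((φ.continuous.tendsto _).comp
          (tendsto_const_nhds.prodMk_nhds (tendsto_concat (p.1.2, p.2)))).sub_const _
      simpa using h1.enorm
  filter_upwards [(ENNReal.tendsto_nhds_zero.1 hmid) (ε / 3) (pos_iff_ne_zero.2 hε3)] with k hk
  have hdm : Measurable fun q => ‖u q - φ q‖ₑ := (hum.sub hφm).enorm
  have h1 : ∫⁻ p, ‖u (p.1.1, concat k (p.1.2, p.2)) - φ (p.1.1, concat k (p.1.2, p.2))‖ₑ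
      ∂((μ.prod N.νinf).prod N.νinf) ≤ ε / 3 := by
    exact ((hc k).lintegral_comp hdm).le.trans hφ
  have h2 : ∫⁻ p, ‖u p.1 - φ p.1‖ₑ ∂((μ.prod N.νinf).prod N.νinf) ≤ ε / 3 := by
    exact (hfst.lintegral_comp hdm).le.trans hφ
  calc ∫⁻ p, ‖u (p.1.1, concat k (p.1.2, p.2)) - u p.1‖ₑ ∂((μ.prod N.νinf).prod N.νinf)
      ≤ ∫⁻ p, (‖u (p.1.1, concat k (p.1.2, p.2)) - φ (p.1.1, concat k (p.1.2, p.2))‖ₑ +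
          ‖u p.1 - φ p.1‖ₑ) + ‖φ (p.1.1, concat k (p.1.2, p.2)) - φ p.1‖ₑ
          ∂((μ.prod N.νinf).prod N.νinf) := by
        refine lintegral_mono fun p => ?_
        have : u (p.1.1, concat k (p.1.2, p.2)) - u p.1 =
            ((u (p.1.1, concat k (p.1.2, p.2)) - φ (p.1.1, concat k (p.1.2, p.2))) -
              (u p.1 - φ p.1)) + (φ (p.1.1, concat k (p.1.2, p.2)) - φ p.1) := by ring
        simp only [this]
        exact (enorm_add_le _ _).trans (add_le_add enorm_sub_le le_rfl)
    _ ≤ (ε / 3 + ε / 3) + ε / 3 := by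
        have hm1 := hdm.comp (hc k).measurable
        have hm2 := hdm.comp hfst.measurable
        refine (lintegral_add_left (hm1.add hm2) _).le.trans ?_
        refine (add_le_add (lintegral_add_left hm1 _).le le_rfl).trans ?_
        exact add_le_add (add_le_add h1 h2) hk
    _ = ε := ENNReal.add_thirds ε

/-- A zero-one law: a shift-invariant set essentially only depends on the initial point. -/
lemma IsStationary.ae_ae_mem_or_ae_notMem {μ : Measure M} (hμ : N.IsStationary μ)
    {A : Set (M × N.Δ)} (hA : MeasurableSet A) (hinv : N.shift ⁻¹' A = A) :
    ∀ᵐ x ∂μ, (∀ᵐ t ∂N.νinf, (x, t) ∈ A) ∨ ∀ᵐ t ∂N.νinf, (x, t) ∉ A := by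
  have := hμ.1
  set u : M × N.Δ → ℝ := A.indicator 1 with hu
  have hum : Measurable u := measurable_one.indicator hA
  have hui : Integrable u (μ.prod N.νinf) := (integrable_const (1 : ℝ)).indicator hA
  have hush : ∀ k p, u (N.shift^[k] p) = u p := by
    intro k p
    have h2 := N.iterate_shift_mem_iff hinv k p
    by_cases hp : p ∈ A
    · rw [hu, indicator_of_mem hp, indicator_of_mem (h2.2 hp)]
      rfl
    · rw [hu, indicator_of_notMem hp, indicator_of_notMem (mt h2.1 hp)]
  have hwm : Measurable fun p : (M × N.Δ) × N.Δ => ‖u (p.1.1, p.2) - u p.1‖ₑ :=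
    ((hum.comp ((measurable_fst.comp measurable_fst).prodMk measurable_snd)).sub
      (hum.comp measurable_fst)).enorm
  -- Applying the shift `k` times leaves `u` unchanged and turns the resampled tail into a fresh
  -- noise from time zero. By stationarity the integral is then independent of `k`; since it tends
  -- to `0`, `u (x, ·)` is almost surely constant.
  have hconst : ∀ k, ∫⁻ p, ‖u (p.1.1, concat k (p.1.2, p.2)) - u p.1‖ₑ
      ∂((μ.prod N.νinf).prod N.νinf) =
      ∫⁻ p, ‖u (p.1.1, p.2) - u p.1‖ₑ ∂((μ.prod N.νinf).prod N.νinf) := by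
    intro k
    rw [← ((hμ.2.iterate k).prod (MeasurePreserving.id N.νinf)).lintegral_comp hwm]
    refine lintegral_congr fun p => ?_
    rw [← hush k (p.1.1, concat k (p.1.2, p.2)), ← hush k p.1]
    simp only [iterate_shift, iter_concat, concat_add, Prod.map_fst, Prod.map_snd, id]
  have hzero := tendsto_lintegral_enorm_concat_sub μ hum hui
  simp only [hconst] at hzero
  have h0 := tendsto_nhds_unique tendsto_const_nhds hzero
  rw [lintegral_eq_zero_iff hwm] at h0
  have h1 := Measure.ae_ae_of_ae_prod (Measure.ae_ae_of_ae_prod h0)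
  filter_upwards [h1] with x hx
  obtain ⟨t, ht⟩ := hx.exists
  have h2 : ∀ t', ‖u (x, t') - u (x, t)‖ₑ = 0 → u (x, t') = u (x, t) := fun t' h => by
    rwa [enorm_eq_zero, sub_eq_zero] at h
  by_cases hxt : (x, t) ∈ A
  · left
    filter_upwards [ht] with t' ht'
    have h3 := h2 t' ht'
    by_contra hcon
    rw [hu, indicator_of_mem hxt, indicator_of_notMem hcon] at h3
    exact zero_ne_one h3
  · right
    filter_upwards [ht] with t' ht' hcon
    have h3 := h2 t' ht'
    rw [hu, indicator_of_notMem hxt, indicator_of_mem hcon] at h3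
    exact one_ne_zero h3

end ZeroOne

/-! ### Minimal invariant sets. -/

section Minimal

/-- Minimal nonempty closed forward invariant sets. -/
structure IsMinimalInvariant (N : ParametricNoise d n M) (C : Set M) : Prop where
  isClosed : IsClosed C
  nonempty : C.Nonempty
  invariant : N.IsForwardInvariant C
  eq_of_subset : ∀ D ⊆ C, IsClosed D → D.Nonempty → N.IsForwardInvariant D → D = C

lemma IsMinimalInvariant.eq_of_mem {C D : Set M} (hC : N.IsMinimalInvariant C)
    (hD : N.IsMinimalInvariant D) {x : M} (hxC : x ∈ C) (hxD : x ∈ D) : C = D := by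
  have h1 : IsClosed (C ∩ D) := hC.isClosed.inter hD.isClosed
  have h2 : N.IsForwardInvariant (C ∩ D) := fun y hy s =>
    ⟨hC.invariant y hy.1 s, hD.invariant y hy.2 s⟩
  rw [← hC.eq_of_subset _ inter_subset_left h1 ⟨x, hxC, hxD⟩ h2,
    hD.eq_of_subset _ inter_subset_right h1 ⟨x, hxC, hxD⟩ h2]

/-- Both sets contain the orbit at time `k + k'`. -/
lemma IsMinimalInvariant.eq_of_iter_mem {C D : Set M} (hC : N.IsMinimalInvariant C)
    (hD : N.IsMinimalInvariant D) {x : M} {t : N.Δ} {k k' : ℕ} (hk : N.iter k x t ∈ C)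
    (hk' : N.iter k' x t ∈ D) : C = D := by
  have h1 := hC.invariant.iter_mem k' hk (fun q => t (q + k))
  have h2 := hD.invariant.iter_mem k hk' (fun q => t (q + k'))
  rw [← N.iter_add] at h1 h2
  rw [add_comm] at h2
  exact hC.eq_of_mem hD h1 h2

variable [CompactSpace M]

lemma exists_isMinimalInvariant_subset {F : Set M} (hF : N.IsForwardInvariant F)
    (hFc : IsClosed F) (hne : F.Nonempty) : ∃ C ⊆ F, N.IsMinimalInvariant C := by
  set S : Set (Set M) := {D | IsClosed D ∧ D.Nonempty ∧ N.IsForwardInvariant D}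
  obtain ⟨C, hCF, hC⟩ := zorn_superset_nonempty S (fun c hcS hchain hcne => by
    refine ⟨⋂₀ c, ⟨isClosed_sInter fun D hD => (hcS hD).1, ?_, ?_⟩, fun D hD => sInter_subset_of_mem hD⟩
    · have : Nonempty c := hcne.to_subtype
      rw [sInter_eq_iInter]
      refine IsCompact.nonempty_iInter_of_directed_nonempty_isCompact_isClosed _ ?_
        (fun D => (hcS D.2).2.1) (fun D => (hcS D.2).1.isCompact) (fun D => (hcS D.2).1)
      rintro ⟨D, hD⟩ ⟨D', hD'⟩
      rcases hchain.total hD hD' with h | h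
      · exact ⟨⟨D, hD⟩, subset_rfl, h⟩
      · exact ⟨⟨D', hD'⟩, h, subset_rfl⟩
    · exact fun x hx s D hD => (hcS hD).2.2 x (hx D hD) s) F ⟨hFc, hne, hF⟩
  exact ⟨C, hCF, hC.prop.1, hC.prop.2.1, hC.prop.2.2, fun D hDC h1 h2 h3 =>
    hDC.antisymm (hC.le_of_le ⟨h1, h2, h3⟩ hDC)⟩

/-- Each minimal set contains a ball of radius `ξ`. If two centres lie in the same ball of a finite
cover by radius `ξ / 2`, the sets meet and coincide. -/
lemma finite_setOf_isMinimalInvariant [Nonempty M] {k : ℕ} {c : M → M} {ξ : ℝ} (hξ : 0 < ξ)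
    (hA : ∀ x, ball (c x) ξ ⊆ range (N.iter k x)) : {C | N.IsMinimalInvariant C}.Finite := by
  have hball : ∀ C, N.IsMinimalInvariant C → ∃ y, ball y ξ ⊆ C := fun C hC => by
    obtain ⟨x, hx⟩ := hC.nonempty
    refine ⟨c x, (hA x).trans ?_⟩
    rintro _ ⟨t, rfl⟩
    exact hC.invariant.iter_mem k hx t
  choose! y hy using hball
  obtain ⟨s, -, hs, hcover⟩ := finite_cover_balls_of_compact (isCompact_univ (X := M)) (half_pos hξ)
  have hcov : ∀ C, ∃ z ∈ s, y C ∈ ball z (ξ / 2) := fun C => by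
    simpa using hcover (mem_univ (y C))
  choose z hz hyz using hcov
  refine Finite.of_finite_image (f := z) (hs.subset (image_subset_iff.2 fun C _ => hz C)) ?_
  intro C hC D hD hCD
  have h1 : y D ∈ ball (y C) ξ := by
    have h2 := hyz C
    have h3 := hyz D
    rw [← hCD] at h3
    rw [mem_ball] at h2 h3 ⊢
    linarith [dist_triangle_right (y D) (y C) (z C)]
  exact IsMinimalInvariant.eq_of_mem hC hD (hy C hC h1) (hy D hD (mem_ball_self hξ))

end Minimal

/-! ### Ergodicity on a minimal set. -/

section Ergodic

variable [MeasurableSpace M] [BorelSpace M]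

variable {m : Measure M}

/-- By stationarity `μ` is the `μ`-average of the laws of the `k`-th iterates. -/
lemma IsStationary.absolutelyContinuous {μ : Measure M} (hμ : N.IsStationary μ) {k : ℕ}
    (hB : ∀ x, N.νinf.map (N.iter k x) ≪ m) : μ ≪ m := by
  have := hμ.1
  refine Measure.AbsolutelyContinuous.mk fun s hs hms => ?_
  have h1 : (μ.prod N.νinf) (Prod.fst ⁻¹' s) = μ s :=
    measurePreserving_fst.measure_preimage hs.nullMeasurableSet
  have hs' : MeasurableSet (Prod.fst ⁻¹' s : Set (M × N.Δ)) := measurable_fst hs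
  rw [← h1, ← (hμ.2.iterate k).measure_preimage hs'.nullMeasurableSet,
    Measure.measure_prod_null ((hμ.2.iterate k).measurable hs')]
  refine Eventually.of_forall fun x => ?_
  have h2 := hB x hms
  rw [Measure.map_apply (N.measurable_iter k x) hs] at h2
  refine measure_mono_null (fun t ht => ?_) h2
  simpa [iterate_shift] using ht

variable [CompactSpace M] [IsManifold (𝓡 d) ∞ M]

/-- If a shift-invariant property holds almost surely for a set of positive volume of initial
points in a minimal set, then it holds almost surely for all initial points in this set. -/
lemma IsMinimalInvariant.forall_ae_mem {C : Set M} (hC : N.IsMinimalInvariant C)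
    (hm : ∀ e ∈ atlas (EuclideanSpace ℝ (Fin d)) M, ∀ s : Set M, MeasurableSet s → s ⊆ e.source →
      volume (e.target ∩ e.symm ⁻¹' s) = 0 → m s = 0)
    {K : ℕ} {c : M → M} {ξ : ℝ} (hξ : 0 < ξ) (hA : ∀ x, ball (c x) ξ ⊆ range (N.iter (K + 1) x))
    (hB : ∀ k ≥ K, ∀ x, N.νinf.map (N.iter k x) ≪ m)
    {A : Set (M × N.Δ)} (hAm : MeasurableSet A) (hinv : N.shift ⁻¹' A = A)
    (hpos : m {x ∈ C | ∀ᵐ t ∂N.νinf, (x, t) ∈ A} ≠ 0) :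
    ∀ x ∈ C, ∀ᵐ t ∂N.νinf, (x, t) ∈ A := by
  set E : Set M := {x ∈ C | ∀ᵐ t ∂N.νinf, (x, t) ∈ A} with hE
  have hEm : MeasurableSet E := by
    have h1 : Measurable fun x => N.νinf (Prod.mk x ⁻¹' Aᶜ) :=
      measurable_measure_prodMk_left hAm.compl
    exact hC.isClosed.measurableSet.inter (h1 (measurableSet_singleton 0))
  have hstep : ∀ x ∈ E, ∀ᵐ s : N.T ∂N.ν, N.f x s ∈ E := by
    rintro x ⟨hxC, hx⟩
    have h1 : ∀ᵐ t ∂N.νinf, (N.iter 1 x t, fun j => t (j + 1)) ∈ A := by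
      filter_upwards [hx] with t ht
      have := (N.iterate_shift_mem_iff hinv 1 (x, t)).2 ht
      rwa [iterate_shift] at this
    have h2 := (N.ae_iterate_shift_iff 1 hAm x).1 h1
    have h3 : MeasurableSet {s : N.T | N.f x s ∈ E} :=
      (N.continuous_step.comp (Continuous.prodMk_right x)).measurable hEm
    have hev := measurePreserving_eval_infinitePi (fun _ : ℕ => N.ν) 0
    rw [← hev.map_eq]
    refine (ae_map_iff hev.measurable.aemeasurable h3).2 ?_
    have h4 : ∀ᵐ t ∂N.νinf, N.f x (t 0) ∈ E := by
      filter_upwards [h2] with t ht using ⟨hC.invariant x hxC (t 0), ht⟩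
    exact h4
  obtain ⟨x₀, hx₀, hU⟩ := N.exists_measure_range_iter_sdiff_eq_zero hm hEm hstep hpos
  set U : Set M := ball (c x₀) ξ
  have hUE : m (U \ E) = 0 := hU K U isOpen_ball (hA x₀)
  have hUC : U ⊆ C := (hA x₀).trans (by
    rintro _ ⟨t, rfl⟩
    exact hC.invariant.iter_mem _ hx₀.1 t)
  have hit : ∀ x ∈ C, ∀ᵐ t ∂N.νinf, ∃ k, N.iter k x t ∈ U := fun x hx =>
    hC.invariant.ae_exists_iter_mem hC.isClosed isOpen_ball (fun D hD h1 h2 h3 => by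
      rw [hC.eq_of_subset D hD h1 h2 h3]
      exact ⟨c x₀, hUC (mem_ball_self hξ), mem_ball_self hξ⟩) hx
  intro y hy
  -- Restarting at time `K` makes the visit to `U` happen when the law of the orbit is absolutely
  -- continuous, so the null set `U \ E` is avoided.
  have h1 : ∀ᵐ t ∂N.νinf,
      (N.iter K y t, fun j => t (j + K)) ∈ {p : M × N.Δ | ∃ k, N.iter k p.1 p.2 ∈ U} :=
    (N.ae_iterate_shift_iff K (isOpen_setOf_exists_iter_mem isOpen_ball).measurableSet y).2
      (Eventually.of_forall fun t => hit _ (hC.invariant.iter_mem K hy t))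
  have h2 : ∀ᵐ t ∂N.νinf, ∀ k, N.iter (k + K) y t ∉ U \ E := by
    refine ae_all_iff.2 fun k => ?_
    have h3 := hB (k + K) (by omega) y hUE
    rw [Measure.map_apply (N.measurable_iter _ y) (isOpen_ball.measurableSet.diff hEm)] at h3
    exact measure_eq_zero_iff_ae_notMem.1 h3
  have h3 := N.ae_forall_iter_mem_imp hAm hinv hEm (fun x hx => hx.2) y
  filter_upwards [h1, h2, h3] with t ⟨k, hk⟩ ht2 ht3
  refine ht3 (k + K) ?_
  by_contra hcon
  exact ht2 k ⟨by rw [iter_add]; exact hk, hcon⟩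

lemma IsMinimalInvariant.isStationaryErgodic {C : Set M} (hC : N.IsMinimalInvariant C)
    (hm : ∀ e ∈ atlas (EuclideanSpace ℝ (Fin d)) M, ∀ s : Set M, MeasurableSet s → s ⊆ e.source →
      volume (e.target ∩ e.symm ⁻¹' s) = 0 → m s = 0)
    {K : ℕ} {c : M → M} {ξ : ℝ} (hξ : 0 < ξ) (hA : ∀ x, ball (c x) ξ ⊆ range (N.iter (K + 1) x))
    (hB : ∀ k ≥ K, ∀ x, N.νinf.map (N.iter k x) ≪ m)
    {μ : Measure M} (hμ : N.IsStationary μ) (hμC : μ Cᶜ = 0) : N.IsStationaryErgodic μ := by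
  have := hμ.1
  refine ⟨hμ, { hμ.2 with aeconst_set := fun A hAm hinv => ?_ }⟩
  rw [eventuallyConst_set]
  have hzo := hμ.ae_ae_mem_or_ae_notMem hAm hinv
  have hCae : ∀ᵐ x ∂μ, x ∈ C := hμC
  -- If this set is `m`-null it is `μ`-null, and the zero-one law leaves the complement of `A`;
  -- otherwise `A` holds almost surely from every point of `C`.
  by_cases hpos : m {x ∈ C | ∀ᵐ t ∂N.νinf, (x, t) ∈ A} = 0
  · right
    have h1 := hμ.absolutelyContinuous (hB K le_rfl) hpos
    refine (Measure.ae_prod_iff_ae_ae hAm.compl).2 ?_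
    filter_upwards [hzo, hCae, measure_eq_zero_iff_ae_notMem.1 h1] with x hx hxC hx'
    exact hx.resolve_left fun h => hx' ⟨hxC, h⟩
  · left
    have h1 := hC.forall_ae_mem hm hξ hA hB hAm hinv hpos
    refine (Measure.ae_prod_iff_ae_ae hAm).2 ?_
    filter_upwards [hCae] with x hx using h1 x hx

end Ergodic

end ParametricNoise

namespace ParametricNoise

variable {d n : ℕ} {M : Type*} [MetricSpace M] [CompactSpace M]
    [ChartedSpace (EuclideanSpace ℝ (Fin d)) M] {N : ParametricNoise d n M}

/-! ### Convergence of time averages and physical measures. -/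

section Averages

lemma tendsto_average_shift_iff (φ : C(M, ℝ)) (p : M × N.Δ) (a : ℝ) :
    Tendsto (fun k : ℕ => (k : ℝ)⁻¹ * ∑ j ∈ Finset.range k,
        φ (N.iter j (N.shift p).1 (N.shift p).2)) atTop (𝓝 a) ↔
      Tendsto (fun k : ℕ => (k : ℝ)⁻¹ * ∑ j ∈ Finset.range k, φ (N.iter j p.1 p.2)) atTop (𝓝 a) := by
  have hdiff : Tendsto (fun k : ℕ => (k : ℝ)⁻¹ * ∑ j ∈ Finset.range k,
      φ (N.iter j (N.shift p).1 (N.shift p).2) -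
      (k : ℝ)⁻¹ * ∑ j ∈ Finset.range k, φ (N.iter j p.1 p.2)) atTop (𝓝 0) := by
    have h1 : Tendsto (fun k : ℕ => (k : ℝ)⁻¹ * (2 * ‖φ‖)) atTop (𝓝 0) := by
      simpa using (tendsto_inv_atTop_nhds_zero_nat (𝕜 := ℝ)).mul_const (2 * ‖φ‖)
    refine squeeze_zero_norm (fun k => ?_) h1
    have h2 : ∀ j, N.iter j (N.shift p).1 (N.shift p).2 = N.iter (j + 1) p.1 p.2 := fun j =>
      (N.iter_succ' j p.1 p.2).symm
    simp only [h2]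
    rw [← mul_sub, ← Finset.sum_sub_distrib,
      Finset.sum_range_sub (fun j => φ (N.iter j p.1 p.2)), norm_mul, norm_inv, Real.norm_natCast]
    gcongr
    refine (norm_sub_le _ _).trans ?_
    linarith [φ.norm_coe_le_norm (N.iter k p.1 p.2), φ.norm_coe_le_norm (N.iter 0 p.1 p.2)]
  constructor
  · intro h
    simpa using h.sub hdiff
  · intro h
    simpa using hdiff.add h

variable [MeasurableSpace M] [BorelSpace M]

lemma averagesTo_of_dense {μ : Measure M} [IsProbabilityMeasure μ] {x : M} {t : N.Δ}
    {s : Set C(M, ℝ)} (hs : Dense s)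
    (h : ∀ φ ∈ s, Tendsto (fun k : ℕ => (k : ℝ)⁻¹ * ∑ j ∈ Finset.range k, φ (N.iter j x t)) atTop
      (𝓝 (∫ z, φ z ∂μ))) : N.AveragesTo μ x t := by
  -- A three-`ε` argument; the index condition `k > k₀` also ensures `k ≠ 0` in the division.
  intro φ
  rw [Metric.tendsto_atTop']
  intro ε hε
  obtain ⟨ψ, hψs, hψ⟩ := hs.exists_dist_lt φ (show 0 < ε / 3 by positivity)
  obtain ⟨k₀, hk₀⟩ := Metric.tendsto_atTop'.1 (h ψ hψs) (ε / 3) (by positivity)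
  refine ⟨k₀, fun k hk => ?_⟩
  have h1 := hk₀ k hk
  have hpt : ∀ y, |φ y - ψ y| ≤ ε / 3 := fun y => by
    rw [← Real.dist_eq]
    exact (ContinuousMap.dist_apply_le_dist y).trans hψ.le
  have h2 : dist ((k : ℝ)⁻¹ * ∑ j ∈ Finset.range k, φ (N.iter j x t))
      ((k : ℝ)⁻¹ * ∑ j ∈ Finset.range k, ψ (N.iter j x t)) ≤ ε / 3 := by
    have hk0 : (0 : ℝ) < k := by exact_mod_cast (Nat.zero_le _).trans_lt hk
    rw [Real.dist_eq, ← mul_sub, ← Finset.sum_sub_distrib, abs_mul, abs_of_pos (inv_pos.2 hk0),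
      inv_mul_le_iff₀ hk0]
    refine (Finset.abs_sum_le_sum_abs _ _).trans ((Finset.sum_le_sum fun j _ => hpt _).trans ?_)
    simp
  have h3 : dist (∫ z, ψ z ∂μ) (∫ z, φ z ∂μ) ≤ ε / 3 := by
    rw [Real.dist_eq, ← integral_sub (integrable_of_continuous ψ.continuous)
      (integrable_of_continuous φ.continuous)]
    have := norm_integral_le_of_norm_le_const (μ := μ) (f := fun z => ψ z - φ z) (C := ε / 3)
      (Eventually.of_forall fun z => by rw [Real.norm_eq_abs, abs_sub_comm]; exact hpt z)
    simpa using this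
  have h4 := dist_triangle4 ((k : ℝ)⁻¹ * ∑ j ∈ Finset.range k, φ (N.iter j x t))
    ((k : ℝ)⁻¹ * ∑ j ∈ Finset.range k, ψ (N.iter j x t)) (∫ z, ψ z ∂μ) (∫ z, φ z ∂μ)
  rcases h2.lt_or_eq with h5 | h5
  · linarith
  · linarith

/-- The set of `(x, t)` whose averages converge is measurable and shift-invariant, and it has full
measure when the limit is given by a stationary ergodic measure. -/
lemma IsStationaryErgodic.exists_averagesTo {μ : Measure M} (hμ : N.IsStationaryErgodic μ) :
    ∃ A : Set (M × N.Δ), MeasurableSet A ∧ N.shift ⁻¹' A = A ∧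
      (∀ᵐ p ∂(μ.prod N.νinf), p ∈ A) ∧ ∀ p ∈ A, N.AveragesTo μ p.1 p.2 := by
  have := hμ.1.1
  let D : ℕ → C(M, ℝ) := TopologicalSpace.denseSeq C(M, ℝ)
  refine ⟨{p | ∀ i, Tendsto (fun k : ℕ => (k : ℝ)⁻¹ * ∑ j ∈ Finset.range k,
    D i (N.iter j p.1 p.2)) atTop (𝓝 (∫ z, D i z ∂μ))}, ?_, ?_, ?_, ?_⟩
  · simp only [ofPred_forall]
    refine MeasurableSet.iInter fun i => measurableSet_tendsto _ fun k => ?_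
    exact (Finset.measurable_sum _ fun j _ =>
      (D i).continuous.measurable.comp (N.continuous_iter j).measurable).const_mul _
  · ext p
    exact forall_congr' fun i => tendsto_average_shift_iff (D i) p _
  · refine ae_all_iff.2 fun i => ?_
    have hm : Measurable fun p : M × N.Δ => D i p.1 :=
      (D i).continuous.measurable.comp measurable_fst
    have hi : Integrable (fun p : M × N.Δ => D i p.1) (μ.prod N.νinf) :=
      integrable_of_continuous ((D i).continuous.comp continuous_fst)
    have hint : ∫ p, D i p.1 ∂(μ.prod N.νinf) = ∫ z, D i z ∂μ := by
      rw [integral_prod _ hi]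
      simp
    filter_upwards [hμ.2.ae_tendsto_birkhoffAverage hm hi] with p hp
    simpa only [iterate_shift, hint] using hp
  · intro p hp
    refine averagesTo_of_dense (TopologicalSpace.denseRange_denseSeq C(M, ℝ)) ?_
    rintro _ ⟨i, rfl⟩
    exact hp i

end Averages

section Minimal

variable [MeasurableSpace M] [BorelSpace M]

/-- A minimal set carries a physical measure that describes almost all orbits entering the set. -/
lemma IsMinimalInvariant.exists_isPhysical [IsManifold (𝓡 d) ∞ M] {m : Measure M} {C : Set M}
    (hC : N.IsMinimalInvariant C)
    (hm : ∀ e ∈ atlas (EuclideanSpace ℝ (Fin d)) M, ∀ s : Set M, MeasurableSet s → s ⊆ e.source →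
      volume (e.target ∩ e.symm ⁻¹' s) = 0 → m s = 0)
    {K : ℕ} {c : M → M} {ξ : ℝ} (hξ : 0 < ξ) (hA : ∀ x, ball (c x) ξ ⊆ range (N.iter (K + 1) x))
    (hB : ∀ k ≥ K, ∀ x, N.νinf.map (N.iter k x) ≪ m) :
    ∃ μ : Measure M, N.IsPhysical m μ ∧ μ ≪ m ∧ μ Cᶜ = 0 ∧
      ∀ x, ∀ᵐ t ∂N.νinf, (∃ k, N.iter k x t ∈ C) → N.AveragesTo μ x t := by
  obtain ⟨μ, hμs, hμC⟩ := exists_isStationary hC.invariant hC.isClosed hC.nonempty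
  have := hμs.1
  have hμe : N.IsStationaryErgodic μ := hC.isStationaryErgodic hm hξ hA hB hμs hμC
  have hμm : μ ≪ m := hμs.absolutelyContinuous (hB K le_rfl)
  obtain ⟨A, hAm, hinv, hae, havg⟩ := hμe.exists_averagesTo
  -- By Birkhoff this set has full `μ`-measure, so `μ ≪ m` prevents it from being `m`-null.
  have hpos : m {x ∈ C | ∀ᵐ t ∂N.νinf, (x, t) ∈ A} ≠ 0 := fun h0 => by
    have hCae : ∀ᵐ x ∂μ, x ∈ C := hμC
    obtain ⟨x, hx1, hx2, hx3⟩ := (hCae.and ((Measure.ae_ae_of_ae_prod hae).and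
      (measure_eq_zero_iff_ae_notMem.1 (hμm h0)))).exists
    exact hx3 ⟨hx1, hx2⟩
  have hCA := hC.forall_ae_mem hm hξ hA hB hAm hinv hpos
  refine ⟨μ, ⟨hμe, (pos_iff_ne_zero.2 hpos).trans_le (measure_mono ?_)⟩, hμm, hμC, fun x => ?_⟩
  · rintro x ⟨-, hx⟩
    exact hx.mono fun t ht => havg (x, t) ht
  · filter_upwards [N.ae_forall_iter_mem_imp hAm hinv hC.isClosed.measurableSet hCA x] with t ht
    rintro ⟨k, hk⟩
    exact havg (x, t) (ht k hk)

/-- Almost every orbit enters the interior of some minimal set. -/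
lemma ae_exists_isMinimalInvariant_iter_mem {K : ℕ} {c : M → M} {ξ : ℝ} (hξ : 0 < ξ)
    (hA : ∀ x, ball (c x) ξ ⊆ range (N.iter K x)) (x : M) :
    ∀ᵐ t ∂N.νinf, ∃ C, N.IsMinimalInvariant C ∧ ∃ k, N.iter k x t ∈ interior C := by
  have hinv : N.IsForwardInvariant univ := fun _ _ _ => trivial
  have h := hinv.ae_exists_iter_mem isClosed_univ (O := ⋃ C ∈ {C | N.IsMinimalInvariant C}, interior C)
    (isOpen_biUnion fun C _ => isOpen_interior) (fun D _ hDc hDne hDi => by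
      obtain ⟨C, hCD, hC⟩ := exists_isMinimalInvariant_subset hDi hDc hDne
      obtain ⟨z, hz⟩ := hC.nonempty
      have hball : ball (c z) ξ ⊆ C := (hA z).trans (by
        rintro _ ⟨t, rfl⟩
        exact hC.invariant.iter_mem _ hz t)
      have hmem := mem_interior.2 ⟨_, hball, isOpen_ball, mem_ball_self hξ⟩
      exact ⟨_, hCD (interior_subset hmem), mem_iUnion₂.2 ⟨C, hC, hmem⟩⟩) (mem_univ x)
  filter_upwards [h] with t ⟨k, hk⟩
  obtain ⟨C, hC, hkC⟩ := mem_iUnion₂.1 hk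
  exact ⟨C, hC, k, hkC⟩

end Minimal

end ParametricNoise

/-! ### Assembly of the theorem. -/

lemma IsNormalizedRiemannianVolume.measure_eq_zero {d : ℕ} {M : Type*} [TopologicalSpace M]
    [ChartedSpace (EuclideanSpace ℝ (Fin d)) M] [IsManifold (𝓡 d) ∞ M] [MeasurableSpace M]
    {g : SmoothRiemannianMetric d M} {m : Measure M} (hm : IsNormalizedRiemannianVolume g m)
    {e : OpenPartialHomeomorph M (EuclideanSpace ℝ (Fin d))}
    (he : e ∈ atlas (EuclideanSpace ℝ (Fin d)) M) {s : Set M} (hs : MeasurableSet s)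
    (hse : s ⊆ e.source) (h : volume (e.target ∩ e.symm ⁻¹' s) = 0) : m s = 0 := by
  obtain ⟨-, vol, hvol, rfl⟩ := hm
  rw [Measure.smul_apply, hvol e he s hs hse, e.image_eq_target_inter_inv_preimage hse,
    setLIntegral_measure_zero _ _ h, smul_zero]

theorem theorem1 {d n : ℕ} (hn : 1 ≤ n) {M : Type*} [MetricSpace M] [CompactSpace M]
    [ConnectedSpace M] [MeasurableSpace M] [BorelSpace M]
    [ChartedSpace (EuclideanSpace ℝ (Fin d)) M] [IsManifold (𝓡 d) ∞ M]
    -- the distance of `M` is the one given by some Riemannian metric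
    [Bundle.RiemannianBundle (fun x : M => TangentSpace (𝓡 d) x)]
    [IsContMDiffRiemannianBundle (𝓡 d) ∞ (EuclideanSpace ℝ (Fin d))
      (fun x : M => TangentSpace (𝓡 d) x)]
    [IsRiemannianManifold (𝓡 d) M]
    -- `m` is the normalized volume of some (possibly different) Riemannian metric
    (g : SmoothRiemannianMetric d M) (m : Measure M) (hm : IsNormalizedRiemannianVolume g m)
    -- a `C^r` diffeomorphism that is the member `f_a` of a family under parametric noise
    (r : ℕ∞) (hr : 1 ≤ r) (f₀ : M ≃ₘ^r⟮𝓡 d, 𝓡 d⟯ M)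
    (N : ParametricNoise d n M) (hf₀ : ∀ x, N.f x N.a = f₀ x)
    (K : ℕ) (ξ₀ : ℝ) (hξ₀ : 0 < ξ₀)
    (hA : ∀ k ≥ K, ∀ x : M, ball (f₀^[k] x) ξ₀ ⊆ range (N.iter k x))
    (hB : ∀ k ≥ K, ∀ x : M, N.νinf.map (N.iter k x) ≪ m) :
    ∃ (l : ℕ) (μ : Fin l → Measure M),
      (∀ i, N.IsPhysical m (μ i) ∧ μ i ≪ m) ∧
      (∀ i j, i ≠ j → Disjoint (μ i).support (μ j).support) ∧
      ∃ V : Fin l → M → Set N.Δ,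
        (∀ x : M,
          (∀ i, IsOpen (V i x)) ∧
          (∀ i j, i ≠ j → Disjoint (V i x) (V j x)) ∧
          N.νinf (⋃ i, V i x)ᶜ = 0 ∧
          (∀ i, ∀ᵐ t ∂N.νinf, t ∈ V i x → N.AveragesTo (μ i) x t)) ∧
        (∀ i, ∀ x : M, Tendsto (fun y => N.νinf (symmDiff (V i y) (V i x))) (𝓝 x) (𝓝 0)) := by
  have hchart : ∀ e ∈ atlas (EuclideanSpace ℝ (Fin d)) M, ∀ s : Set M, MeasurableSet s →
      s ⊆ e.source → volume (e.target ∩ e.symm ⁻¹' s) = 0 → m s = 0 :=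
    fun e he s hs hse h => hm.measure_eq_zero he hs hse h
  -- Time `K + 1` is positive even if `K = 0`, as the transport of density requires.
  have hA' : ∀ x, ball (f₀^[K + 1] x) ξ₀ ⊆ range (N.iter (K + 1) x) := hA (K + 1) (by omega)
  have hfin := ParametricNoise.finite_setOf_isMinimalInvariant hξ₀ hA'
  obtain ⟨l, C, hCinj, hCrange⟩ : ∃ (l : ℕ) (C : Fin l → Set M), Function.Injective C ∧
      range C = {C | N.IsMinimalInvariant C} := by
    have := hfin.to_subtype
    obtain ⟨l, ⟨e⟩⟩ := Finite.exists_equiv_fin {C | N.IsMinimalInvariant C}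
    refine ⟨l, fun i => (e.symm i).1, Subtype.val_injective.comp e.symm.injective, ?_⟩
    rw [show (fun i => (e.symm i).1) = Subtype.val ∘ e.symm from rfl,
      e.symm.surjective.range_comp, Subtype.range_coe]
  have hC : ∀ i, N.IsMinimalInvariant (C i) := fun i => by
    have : C i ∈ range C := mem_range_self i
    rwa [hCrange] at this
  choose μ hμ hμm hμC havg using fun i => (hC i).exists_isPhysical hchart hξ₀ hA' hB
  -- Entering the interior, rather than `C i` itself, makes the condition open in `(x, t)`.
  let G : Fin l → Set (M × N.Δ) := fun i => {p | ∃ k, N.iter k p.1 p.2 ∈ interior (C i)}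
  have hGo : ∀ i, IsOpen (G i) := fun i =>
    ParametricNoise.isOpen_setOf_exists_iter_mem isOpen_interior
  have hGdisj : ∀ x i j, i ≠ j → ∀ t ∈ Prod.mk x ⁻¹' G i, t ∉ Prod.mk x ⁻¹' G j := by
    rintro x i j hij t ⟨k, hk⟩ ⟨k', hk'⟩
    exact hij (hCinj ((hC i).eq_of_iter_mem (hC j) (interior_subset hk) (interior_subset hk')))
  have hGfull : ∀ x, N.νinf (⋃ i, Prod.mk x ⁻¹' G i)ᶜ = 0 := by
    intro x
    refine measure_mono_null ?_ (ParametricNoise.ae_exists_isMinimalInvariant_iter_mem hξ₀ hA' x)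
    rintro t ht ⟨D, hD, k, hk⟩
    obtain ⟨i, rfl⟩ : D ∈ range C := by rw [hCrange]; exact hD
    exact ht (mem_iUnion.2 ⟨i, k, hk⟩)
  refine ⟨l, μ, fun i => ⟨hμ i, hμm i⟩, fun i j hij => ?_, fun i x => Prod.mk x ⁻¹' G i, fun x =>
    ⟨fun i => (hGo i).preimage (Continuous.prodMk_right x),
      fun i j hij => disjoint_left.2 (hGdisj x i j hij), hGfull x, fun i => ?_⟩,
    tendsto_measure_symmDiff_fiber N.νinf hGo hGdisj hGfull⟩
  · have hsupp : ∀ i, (μ i).support ⊆ C i := fun i =>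
      Measure.support_subset_of_isClosed (hC i).isClosed (hμC i)
    exact disjoint_left.2 fun x hi hj => hij (hCinj ((hC i).eq_of_mem (hC j) (hsupp i hi)
      (hsupp j hj)))
  · filter_upwards [havg i x] with t ht
    rintro ⟨k, hk⟩
    exact ht ⟨k, interior_subset hk⟩
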